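/- Let $M$ be a smooth (Hausdorff, finite-dimensional) manifold with a Poisson bivector $\pi$. Write $\#:T^*M\to TM$ for contraction with $\pi$, $\{f,g\}=\pi(df,dg)$ for the Poisson bracket, and $[\xi,\zeta]_\pi=\mathcal L_{\#\xi}\zeta-\mathcal L_{\#\zeta}\xi-d(\pi(\xi,\zeta))$ for the Koszul bracket of 1-forms. For a foliation (smooth involutive subbundle) $\mathcal P_0\subseteq TM$ let $\mathcal P_0^\perp\subseteq T^*M$ be its annihilator. Given a flat, torsion-free $\mathcal P_0$-connection $\nabla$ on $\mathcal P_0$ (a partial connection $\nabla_XY$, defined for sections $X,Y$ of $\mathcal P_0$), a 1-form $\xi$ is called $\nabla$-stable if its class in $T^*M/\mathcal P_0^\perp=\mathcal P_0^*$ is constant for the dual connection, i.e. $X(\xi(Y))=\xi(\nabla_XY)$ for all local sections $X,Y$ of $\mathcal P_0$. A real polarization of $(M,\pi)$ is a pair $(\mathcal P_0,\nabla)$, where $\mathcal P_0$ is a foliation that is coisotropic ($\#\mathcal P_0^\perp\subseteq\mathcal P_0$) and $\nabla$ is a flat, torsion-free $\mathcal P_0$-connection on $\mathcal P_0$, such that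 over any open $U\subseteq M$: (a) the set of $\nabla$-stable 1-forms is closed under the Koszul bracket; (b) the sections of $\mathcal P_0^\perp$ form a Lie ideal inside it; (c) if $f\in C^\infty(U)$ is constant along $\mathcal P_0$, then $\nabla\,\#df=0$. Theorem. Let $(\mathcal P_0,\nabla)$ be a real polarization of the Poisson manifold $(M,\pi)$. Around any point of $M$ there exist smooth coordinates $(x^i,y^\alpha)$ on an open set $U$ such that: 1. the leaves of $\mathcal P_0$ restricted to $U$ are the subspaces of fixed $y$ (and the vector fields $\partial/\partial x^i$ span $\mathcal P_0$ over $U$); 2. $\nabla_i=\partial/\partial x^i$, that is, $\nabla_{\partial/\partial x^i}\bigl(\sum_jY^j\,\partial/\partial x^j\bigr)=\sum_j\frac{\partial Y^j}{\partial x^i}\,\partial/\partial x^j$ for local sections of $\mathcal P_0$; 3. the components $\pi^{\alpha\beta}=\{y^\alpha,y^\beta\}$ vanish; 4. the components $\pi^{i\alpha}=\{x^i,y^\alpha\}$ are constant in the $x$'s, that is, functions of $y$ only; 5. the components $\pi^{ij}=\{x^i,x^j\}$ are affine in the $x$'s, that is, $\pi^{ij}=c^{ij}(y)+\sum_m b^{ij}_m(y)\,x^m$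 for some functions $c^{ij},b^{ij}_m$ of $y$. -/

import Mathlib

open Set
open scoped Manifold ContDiff

noncomputable section

namespace PoissonPolarization

variable (E : Type*) [NormedAddCommGroup E] [NormedSpace ℝ E]
variable (M : Type*) [TopologicalSpace M] [ChartedSpace E M]

/-- A (not necessarily smooth) vector field on `M`. -/
abbrev VecField : Type _ := (x : M) → TangentSpace 𝓘(ℝ, E) x

/-- A (not necessarily smooth) 1-form on `M`. -/
abbrev OneForm : Type _ := (x : M) → (TangentSpace 𝓘(ℝ, E) x →L[ℝ] ℝ)

variable {E M}

/-- The function `f` is smooth on `U`. -/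
def SmoothFun (U : Set M) (f : M → ℝ) : Prop :=
  ContMDiffOn 𝓘(ℝ, E) 𝓘(ℝ, ℝ) ∞ f U

/-- The differential `df`, as a 1-form. -/
def dif (f : M → ℝ) : OneForm E M := fun x ↦ mfderiv 𝓘(ℝ, E) 𝓘(ℝ, ℝ) f x

variable [IsManifold 𝓘(ℝ, E) ∞ M]

/-- The vector field `X` is smooth on `U` (as a section of the tangent bundle). -/
def SmoothField (U : Set M) (X : VecField E M) : Prop :=
  ContMDiffOn 𝓘(ℝ, E) (𝓘(ℝ, E).prod 𝓘(ℝ, E)) ∞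
    (fun x ↦ Bundle.TotalSpace.mk' E (E := fun x : M ↦ TangentSpace 𝓘(ℝ, E) x) x (X x)) U

/-- The 1-form `ξ` is smooth on `U` (as a section of the cotangent bundle). -/
def SmoothForm (U : Set M) (ξ : OneForm E M) : Prop :=
  ContMDiffOn 𝓘(ℝ, E) (𝓘(ℝ, E).prod 𝓘(ℝ, E →L[ℝ] ℝ)) ∞
    (fun x ↦ Bundle.TotalSpace.mk' (E →L[ℝ] ℝ)
      (E := fun x : M ↦ (TangentSpace 𝓘(ℝ, E) x →L[ℝ] Bundle.Trivial M ℝ x)) x (ξ x)) U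

/-- The exterior derivative `dξ` of a 1-form at `x`, as a bilinear form on `T_xM`: with
`A y : E →L[ℝ] ℝ` the expression of `ξ` in the chart `c` at `x`,
`dξ(u, v) = (D_u A) v - (D_v A) u`. -/
def extD (ξ : OneForm E M) (x : M) :
    TangentSpace 𝓘(ℝ, E) x →L[ℝ] TangentSpace 𝓘(ℝ, E) x →L[ℝ] ℝ :=
  let c := chartAt E x
  let A : E → (E →L[ℝ] ℝ) := fun y ↦
    (ξ (c.symm y)).comp (mfderiv 𝓘(ℝ, E) 𝓘(ℝ, E) c.symm y)
  let D : E →L[ℝ] E →L[ℝ] ℝ := fderiv ℝ A (c x)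
  let T : TangentSpace 𝓘(ℝ, E) x →L[ℝ] E := mfderiv 𝓘(ℝ, E) 𝓘(ℝ, E) c x
  (ContinuousLinearMap.precomp ℝ T).comp ((D - D.flip).comp T)

variable (E M)

/-- A Poisson structure, given by the anchor `# : T*M → TM` of its bivector `π`
(`#α` is the contraction of `α` with `π`, that is, `π(α, β) = β(#α)`).
Antisymmetry says that `π` is a bivector, and the bracket `{f, g} = π(df, dg)` of local smooth
functions satisfies the Jacobi identity. -/
structure PoissonStructure where
  sharp : (x : M) → ((TangentSpace 𝓘(ℝ, E) x →L[ℝ] ℝ) →L[ℝ] TangentSpace 𝓘(ℝ, E) x)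
  antisymm : ∀ (x : M) (α β : TangentSpace 𝓘(ℝ, E) x →L[ℝ] ℝ),
    β (sharp x α) = -α (sharp x β)
  smooth : ∀ (U : Set M), IsOpen U → ∀ ξ : OneForm E M,
    SmoothForm U ξ → SmoothField U (fun x ↦ sharp x (ξ x))
  jacobi : ∀ (U : Set M), IsOpen U → ∀ f g h : M → ℝ,
    SmoothFun (E := E) U f → SmoothFun (E := E) U g → SmoothFun (E := E) U h → ∀ x ∈ U,
      dif (fun y ↦ dif h y (sharp y (dif g y))) x (sharp x (dif f x))
      + dif (fun y ↦ dif f y (sharp y (dif h y))) x (sharp x (dif g x))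
      + dif (fun y ↦ dif g y (sharp y (dif f y))) x (sharp x (dif h x)) = 0

/-- A (regular) foliation of `M`, given by its tangent distribution: a smooth involutive
subbundle of `TM`. -/
structure Foliation where
  fiber : (x : M) → Submodule ℝ (TangentSpace 𝓘(ℝ, E) x)
  exists_frame : ∀ x : M, ∃ U : Set M, IsOpen U ∧ x ∈ U ∧
    ∃ (k : ℕ) (e : Fin k → VecField E M), (∀ i, SmoothField U (e i)) ∧
      ∀ y ∈ U, LinearIndependent ℝ (fun i ↦ e i y) ∧
        Submodule.span ℝ (Set.range fun i ↦ e i y) = fiber y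
  involutive : ∀ (U : Set M), IsOpen U → ∀ X Y : VecField E M,
    SmoothField U X → SmoothField U Y →
    (∀ x ∈ U, X x ∈ fiber x) → (∀ x ∈ U, Y x ∈ fiber x) →
    ∀ x ∈ U, VectorField.mlieBracket 𝓘(ℝ, E) X Y x ∈ fiber x

variable {E M}

namespace PoissonStructure

/-- `π(α, β)` for 1-forms. -/
def pair (π : PoissonStructure E M) (α β : OneForm E M) : M → ℝ :=
  fun x ↦ β x (π.sharp x (α x))

/-- The Poisson bracket `{f, g} = π(df, dg)`. -/
def bracket (π : PoissonStructure E M) (f g : M → ℝ) : M → ℝ :=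
  π.pair (dif f) (dif g)

/-- The Koszul bracket of 1-forms,
`[α, β]_π = L_{#α} β - L_{#β} α - d(π(α, β)) = #α ⌟ dβ - #β ⌟ dα + d(π(α, β))`. -/
def koszul (π : PoissonStructure E M) (α β : OneForm E M) : OneForm E M :=
  fun x ↦ extD β x (π.sharp x (α x)) - extD α x (π.sharp x (β x)) + dif (π.pair α β) x

end PoissonStructure

namespace Foliation

/-- A (not necessarily smooth) section of the tangent distribution of the foliation. A section
over an open set is given by any extension of it to `M`. -/
abbrev Sec (P : Foliation E M) : Type _ := (x : M) → P.fiber x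

/-- A section, seen as a vector field. -/
def Sec.field {P : Foliation E M} (X : P.Sec) : VecField E M :=
  fun x ↦ (X x : TangentSpace 𝓘(ℝ, E) x)

/-- `ξ` is over `U` a smooth section of the annihilator of the tangent distribution. -/
def Conormal (P : Foliation E M) (U : Set M) (ξ : OneForm E M) : Prop :=
  SmoothForm U ξ ∧ ∀ x ∈ U, ∀ v ∈ P.fiber x, ξ x v = 0

/-- The leaf through `p` of the foliation restricted to `U`: the points that can be reached from
`p` along smooth curves in `U` that are tangent to the foliation. -/
def leaf (P : Foliation E M) (U : Set M) (p : M) : Set M :=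
  {q | ∃ γ : ℝ → M, ContMDiffOn 𝓘(ℝ, ℝ) 𝓘(ℝ, E) ∞ γ (Icc 0 1) ∧ γ 0 = p ∧ γ 1 = q ∧
    ∀ t ∈ Icc (0 : ℝ) 1, γ t ∈ U ∧
      mfderivWithin 𝓘(ℝ, ℝ) 𝓘(ℝ, E) γ (Icc 0 1) t (1 : ℝ) ∈ P.fiber (γ t)}

end Foliation

/-- A partial connection along the foliation `P`, on the tangent distribution of `P` itself.
`∇.cov Y x v` is the value of `∇_v Y` for `v` in the fiber at `x`; only its values on
sections `Y` that are smooth near `x` are meaningful. -/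
structure PartialConnection (P : Foliation E M) where
  cov : P.Sec → (x : M) → (P.fiber x →ₗ[ℝ] P.fiber x)
  add : ∀ (U : Set M), IsOpen U → ∀ Y Z : P.Sec, SmoothField U Y.field → SmoothField U Z.field →
    ∀ x ∈ U, cov (fun y ↦ Y y + Z y) x = cov Y x + cov Z x
  leibniz : ∀ (U : Set M), IsOpen U → ∀ (f : M → ℝ) (Y : P.Sec), SmoothFun (E := E) U f →
    SmoothField U Y.field → ∀ x ∈ U, ∀ v : P.fiber x,
      cov (fun y ↦ f y • Y y) x v = f x • cov Y x v + (dif f x (v : TangentSpace 𝓘(ℝ, E) x)) • Y x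
  smooth : ∀ (U : Set M), IsOpen U → ∀ X Y : P.Sec, SmoothField U X.field →
    SmoothField U Y.field → SmoothField U (Foliation.Sec.field (fun x ↦ cov Y x (X x)))

namespace PartialConnection

variable {P : Foliation E M}

/-- The section `∇_X Y`. -/
def along (D : PartialConnection P) (X Y : P.Sec) : P.Sec := fun x ↦ D.cov Y x (X x)

/-- The curvature vanishes: `∇_X ∇_Y Z - ∇_Y ∇_X Z - ∇_{[X, Y]} Z = 0`. -/
def Flat (D : PartialConnection P) : Prop :=
  ∀ (U : Set M), IsOpen U → ∀ X Y Z W : P.Sec,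
    SmoothField U X.field → SmoothField U Y.field → SmoothField U Z.field →
    (∀ x ∈ U, W.field x = VectorField.mlieBracket 𝓘(ℝ, E) X.field Y.field x) →
    ∀ x ∈ U, D.along X (D.along Y Z) x - D.along Y (D.along X Z) x - D.along W Z x = 0

/-- The torsion vanishes: `∇_X Y - ∇_Y X = [X, Y]`. -/
def TorsionFree (D : PartialConnection P) : Prop :=
  ∀ (U : Set M), IsOpen U → ∀ X Y : P.Sec, SmoothField U X.field → SmoothField U Y.field →
    ∀ x ∈ U, (D.along X Y).field x - (D.along Y X).field x
      = VectorField.mlieBracket 𝓘(ℝ, E) X.field Y.field x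

/-- The smooth 1-form `ξ` is `∇`-stable over `U`: its class in `T*M / P^⊥ = P*` is constant for
the dual connection, `X(ξ(Y)) = ξ(∇_X Y)` for local smooth sections `X`, `Y` of `P`. -/
def Stable (D : PartialConnection P) (U : Set M) (ξ : OneForm E M) : Prop :=
  SmoothForm U ξ ∧ ∀ (V : Set M), IsOpen V → V ⊆ U → ∀ X Y : P.Sec,
    SmoothField V X.field → SmoothField V Y.field → ∀ x ∈ V,
      dif (fun y ↦ ξ y (Y.field y)) x (X.field x) = ξ x ((D.along X Y).field x)

end PartialConnection

/-- `(P, ∇)` is a real polarization of the Poisson manifold `(M, π)`. -/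
structure IsRealPolarization (π : PoissonStructure E M) (P : Foliation E M)
    (D : PartialConnection P) : Prop where
  /-- `#(P^⊥) ⊆ P` -/
  coisotropic : ∀ (x : M) (α : TangentSpace 𝓘(ℝ, E) x →L[ℝ] ℝ),
    (∀ v ∈ P.fiber x, α v = 0) → π.sharp x α ∈ P.fiber x
  flat : D.Flat
  torsionFree : D.TorsionFree
  /-- The `∇`-stable 1-forms are closed under the Koszul bracket. -/
  stable_koszul : ∀ (U : Set M), IsOpen U → ∀ ξ ζ : OneForm E M,
    D.Stable U ξ → D.Stable U ζ → D.Stable U (π.koszul ξ ζ)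
  /-- The sections of `P^⊥` form a Lie ideal in the `∇`-stable 1-forms. -/
  conormal_ideal : ∀ (U : Set M), IsOpen U → ∀ ξ ζ : OneForm E M,
    D.Stable U ξ → P.Conormal U ζ → P.Conormal U (π.koszul ξ ζ)
  /-- If `f` is constant along `P`, then `∇ #df = 0`. -/
  sharp_parallel : ∀ (U : Set M), IsOpen U → ∀ f : M → ℝ, SmoothFun (E := E) U f →
    (∀ x ∈ U, ∀ v ∈ P.fiber x, dif f x v = 0) →
    ∀ Y : P.Sec, (∀ x ∈ U, Y.field x = π.sharp x (dif f x)) → ∀ x ∈ U, D.cov Y x = 0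

section Coordinates

variable {k l : ℕ}

/-- `φ` is a smooth coordinate system `(x^1, …, x^k, y^1, …, y^l)` on `φ.source`. -/
def IsCoordinates (φ : OpenPartialHomeomorph M ((Fin k → ℝ) × (Fin l → ℝ))) : Prop :=
  ContMDiffOn 𝓘(ℝ, E) 𝓘(ℝ, (Fin k → ℝ) × (Fin l → ℝ)) ∞ φ φ.source ∧
  ContMDiffOn 𝓘(ℝ, (Fin k → ℝ) × (Fin l → ℝ)) 𝓘(ℝ, E) ∞ φ.symm φ.target

/-- The coordinate function `x^i`. -/
def xc (φ : OpenPartialHomeomorph M ((Fin k → ℝ) × (Fin l → ℝ))) (i : Fin k) : M → ℝ :=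
  fun q ↦ (φ q).1 i

/-- The coordinate function `y^a`. -/
def yc (φ : OpenPartialHomeomorph M ((Fin k → ℝ) × (Fin l → ℝ))) (a : Fin l) : M → ℝ :=
  fun q ↦ (φ q).2 a

/-- The coordinate vector field `∂/∂x^i`: at a point `q` of `φ.source`, the tangent vector whose
coordinates are `(e_i, 0)`. -/
def xField (φ : OpenPartialHomeomorph M ((Fin k → ℝ) × (Fin l → ℝ))) (i : Fin k) :
    VecField E M := fun q ↦
  (mfderiv 𝓘(ℝ, E) 𝓘(ℝ, (Fin k → ℝ) × (Fin l → ℝ)) φ q).inverse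
    ((Pi.single i 1, 0) : (Fin k → ℝ) × (Fin l → ℝ))

end Coordinates

end PoissonPolarization

end

open PoissonPolarization

open PoissonPolarization

/-! Everything rests on local coordinates in which the pair (foliation, connection) is standard: `y`
is constant on the leaves and `∇` differentiates `x`-components. A flat torsion-free connection
along the leaves is a leafwise affine structure. Flatness gives parallel coframes `θ` on the leaves,
vanishing torsion makes them closed there, and their primitives `x` are leafwise affine coordinates.
All of this must depend smoothly on the leaf.

Near a point `P` is the graph of `A : X × Y → (X →L[ℝ] Y)` (`exists_isGraphChart`), and `∇` has
Christoffel symbols `Γ` in this chart. The leaf `w`, the coframe `θ` and the coordinates `x` solve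
one total differential equation in `u`: `dw = A`, `dθ = θ ∘ Γ`, `dx = θ`. Its integrability
conditions are involutivity of `P`, flatness and symmetry of `Γ` respectively
(`affineRHS_integrable`). Such equations are solved in `exists_solution_totalDifferentialEquation`:
the integral equations along rays from `u = 0` are solved in a space of continuous paths by the
inverse function theorem, which also gives smooth dependence on the data, and integrability shows
that the solutions along rays fit together. `exists_affine_foliation_coordinates` and
`exists_isAffineChart` carry this back to `M`.

In these coordinates the statements about `π` are short. Coisotropy puts `#dy` into `P`, so `{y, y}
= 0` (`bracket_yc_yc`). Since `y` is constant along `P`, `#dy` is parallel, so its components `{y,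
x}` are constant along the leaves (`bracket_xc_yc`). The forms `dx` are stable, hence so is `[dx^i,
dx^j]_π = d{x^i, x^j}`; its coefficients along the leaves are leafwise constant, which makes `{x^i,
x^j}` affine in `x` (`bracket_xc_xc`). -/

namespace PoissonPolarization

open Filter Topology
universe u

/-! ### Inverse function theorem with a smooth inverse -/

section InverseFunction

/-- The inverse function theorem for maps that are smooth on an open set, with smoothness of the
inverse on its whole domain. -/
theorem exists_smooth_openPartialHomeomorph {Z Z' : Type*} [NormedAddCommGroup Z] [NormedSpace ℝ Z]
    [NormedAddCommGroup Z'] [NormedSpace ℝ Z'] [CompleteSpace Z] {F : Z → Z'} {s : Set Z}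
    (hs : IsOpen s) (hF : ContDiffOn ℝ ∞ F s) {a : Z} (ha : a ∈ s) (L : Z ≃L[ℝ] Z')
    (hL : HasFDerivAt F (L : Z →L[ℝ] Z') a) :
    ∃ e : OpenPartialHomeomorph Z Z', a ∈ e.source ∧ e.source ⊆ s ∧ (∀ z, e z = F z) ∧
      ContDiffOn ℝ ∞ e.symm e.target ∧
      ∀ z ∈ e.source, ∃ L' : Z ≃L[ℝ] Z', HasFDerivAt F (L' : Z →L[ℝ] Z') z := by
  have hn : (∞ : WithTop ℕ∞) ≠ 0 := by simp
  have hFa : ∀ z ∈ s, ContDiffAt ℝ ∞ F z := fun z hz ↦ hF.contDiffAt (hs.mem_nhds hz)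
  set e₀ := (hFa a ha).toOpenPartialHomeomorph F hL hn
  -- Restricting to the open set where the derivative is invertible makes the inverse smooth on the
  -- whole target, not only near `F a`.
  set s' : Set Z := s ∩ fderiv ℝ F ⁻¹' range ((↑) : (Z ≃L[ℝ] Z') → Z →L[ℝ] Z')
  have hs' : IsOpen s' :=
    (hF.continuousOn_fderiv_of_isOpen hs (by simp)).isOpen_inter_preimage hs
      ContinuousLinearEquiv.isOpen
  have has' : a ∈ s' := ⟨ha, L, hL.fderiv.symm⟩
  refine ⟨e₀.restrOpen s' hs', ⟨?_, has'⟩, fun z hz ↦ hz.2.1, fun z ↦ rfl, fun z hz ↦ ?_,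
    fun z hz ↦ ?_⟩
  · exact (hFa a ha).mem_toOpenPartialHomeomorph_source hL hn
  · have hz' := (e₀.restrOpen s' hs').map_target hz
    obtain ⟨h1, h2⟩ := hz'.2
    obtain ⟨L', hL'⟩ := h2
    have hd : HasFDerivAt F (L' : Z →L[ℝ] Z') ((e₀.restrOpen s' hs').symm z) := by
      rw [hL']
      exact ((hFa _ h1).differentiableAt hn).hasFDerivAt
    exact ((e₀.restrOpen s' hs').contDiffAt_symm hz hd (hFa _ h1)).contDiffWithinAt
  · obtain ⟨L', hL'⟩ := hz.2.2
    refine ⟨L', ?_⟩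
    rw [hL']
    exact ((hFa _ hz.2.1).differentiableAt hn).hasFDerivAt

end InverseFunction

/-! ### Smoothness of composition operators on spaces of continuous maps -/

section Nemytskii

variable {K : Type*} [TopologicalSpace K] [CompactSpace K]

/-- The pointwise application of a bilinear map to continuous maps. -/
noncomputable def pointwiseApply (K : Type*) [TopologicalSpace K] [CompactSpace K]
    {W Z Y : Type*} [NormedAddCommGroup W] [NormedSpace ℝ W] [NormedAddCommGroup Z]
    [NormedSpace ℝ Z] [NormedAddCommGroup Y] [NormedSpace ℝ Y] (b : W →L[ℝ] Z →L[ℝ] Y) :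
    C(K, W) →L[ℝ] C(K, Z) →L[ℝ] C(K, Y) :=
  LinearMap.mkContinuous₂
    (LinearMap.mk₂ ℝ (fun (A : C(K, W)) (γ : C(K, Z)) ↦
        (⟨fun s ↦ b (A s) (γ s), by fun_prop⟩ : C(K, Y)))
      (fun _ _ _ ↦ by ext; simp) (fun _ _ _ ↦ by ext; simp)
      (fun _ _ _ ↦ by ext; simp) (fun _ _ _ ↦ by ext; simp)) ‖b‖
    (fun A γ ↦ by
      refine (ContinuousMap.norm_le _ (by positivity)).2 fun s ↦ ?_
      refine (b.le_opNorm₂ _ _).trans ?_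
      gcongr
      · exact A.norm_coe_le_norm s
      · exact γ.norm_coe_le_norm s)

lemma contDiff_pointwiseApply_comp {W Z Y X : Type*} [NormedAddCommGroup W] [NormedSpace ℝ W]
    [NormedAddCommGroup Z] [NormedSpace ℝ Z] [NormedAddCommGroup Y] [NormedSpace ℝ Y]
    [NormedAddCommGroup X] [NormedSpace ℝ X] (b : W →L[ℝ] Z →L[ℝ] Y) {n : WithTop ℕ∞}
    {g : X → C(K, W)} (hg : ContDiff ℝ n g) :
    ContDiff ℝ n (fun x ↦ pointwiseApply K b (g x)) :=
  (pointwiseApply K b).contDiff.comp hg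

/-- The composition operator `γ ↦ f ∘ γ` is differentiable. -/
theorem hasFDerivAt_comp_continuousMap {W Z Y : Type*} [NormedAddCommGroup W] [NormedSpace ℝ W]
    [NormedAddCommGroup Z] [NormedSpace ℝ Z] [NormedAddCommGroup Y] [NormedSpace ℝ Y]
    (b : W →L[ℝ] Z →L[ℝ] Y) (hb : ∀ w, ‖b w‖ ≤ ‖w‖) (f : C(Z, Y)) (f' : C(Z, W))
    (hf : ∀ z, HasFDerivAt f (b (f' z)) z) (γ : C(K, Z)) :
    HasFDerivAt (fun γ : C(K, Z) ↦ f.comp γ) (pointwiseApply K b (f'.comp γ)) γ := by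
  rw [hasFDerivAt_iff_isLittleO, Asymptotics.isLittleO_iff]
  intro c hc
  have hcont : ContinuousAt (fun γ : C(K, Z) ↦ f'.comp γ) γ :=
    (ContinuousMap.continuous_postcomp f').continuousAt
  obtain ⟨r, hr, hball⟩ := Metric.continuousAt_iff.1 hcont c hc
  filter_upwards [Metric.ball_mem_nhds γ hr] with η hη
  refine (ContinuousMap.norm_le _ (by positivity)).2 fun s ↦ ?_
  have hbound : ∀ z ∈ Metric.ball (γ s) r, ‖b (f' z) - b (f' (γ s))‖ ≤ c := by
    intro z hz
    -- The map `γ` translated by `z - γ s` lies within `r` of `γ` and takes the value `z` at `s`.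
    -- Continuity of `γ ↦ f' ∘ γ` therefore bounds `f' z - f' (γ s)` with one radius `r` for all
    -- `s`.
    have h1 : dist (γ + ContinuousMap.const K (z - γ s)) γ < r := by
      rw [dist_eq_norm, add_sub_cancel_left]
      refine lt_of_le_of_lt ((ContinuousMap.norm_le _ (norm_nonneg (z - γ s))).2 fun _ ↦ le_rfl) ?_
      rwa [← dist_eq_norm]
    have h2 := (ContinuousMap.dist_apply_le_dist s).trans (hball h1).le
    rw [← map_sub]
    refine (hb _).trans ?_
    simpa [dist_eq_norm] using h2
  have hηs : η s ∈ Metric.ball (γ s) r :=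
    lt_of_le_of_lt (ContinuousMap.dist_apply_le_dist s) hη
  have := (convex_ball (γ s) r).norm_image_sub_le_of_norm_hasFDerivWithin_le'
    (f := f) (f' := fun z ↦ b (f' z)) (φ := b (f' (γ s)))
    (fun z _ ↦ (hf z).hasFDerivWithinAt) hbound (Metric.mem_ball_self hr) hηs
  refine this.trans ?_
  gcongr
  exact (η - γ).norm_coe_le_norm s

/-- The composition operator `γ ↦ f ∘ γ` with a smooth map `f` is smooth. -/
theorem contDiff_comp_continuousMap {Z : Type u} [NormedAddCommGroup Z] [NormedSpace ℝ Z] (n : ℕ) :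
    ∀ {Y : Type u} [NormedAddCommGroup Y] [NormedSpace ℝ Y] (f : C(Z, Y)), ContDiff ℝ n f →
      ContDiff ℝ n (fun γ : C(K, Z) ↦ f.comp γ) := by
  -- The derivative of composition with `f` is pointwise application of composition with `f'`. The
  -- target of `f'` is `Z →L[ℝ] Y`, so the induction runs over all targets `Y` in one universe.
  induction n with
  | zero =>
    intro Y _ _ f _
    exact contDiff_zero.2 (ContinuousMap.continuous_postcomp f)
  | succ n ih =>
    intro Y _ _ f hf
    obtain ⟨f', hf', hd⟩ := contDiff_succ_iff_hasFDerivAt.1 hf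
    refine contDiff_succ_iff_hasFDerivAt.2 ⟨_, ?_,
      hasFDerivAt_comp_continuousMap (.id ℝ (Z →L[ℝ] Y)) (fun w ↦ le_rfl) f ⟨f', hf'.continuous⟩ hd⟩
    exact contDiff_pointwiseApply_comp _ (ih ⟨f', hf'.continuous⟩ hf')

end Nemytskii

/-! ### Integration as a bounded operator on paths -/

section Volterra

variable (V : Type*) [NormedAddCommGroup V] [NormedSpace ℝ V]

/-- The integration operator `γ ↦ (t ↦ ∫₀ᵗ γ)`. -/
noncomputable def volterra : C(Icc (0 : ℝ) 1, V) →L[ℝ] C(Icc (0 : ℝ) 1, V) :=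
  LinearMap.mkContinuous
    { toFun := fun γ ↦ ⟨fun t ↦ ∫ s in (0 : ℝ)..t, γ (projIcc 0 1 zero_le_one s), by
        have h : Continuous fun t : ℝ ↦ ∫ s in (0 : ℝ)..t, γ (projIcc 0 1 zero_le_one s) :=
          intervalIntegral.continuous_primitive (fun a b ↦ Continuous.intervalIntegrable
            (γ.continuous.comp continuous_projIcc) a b) 0
        exact h.comp continuous_subtype_val⟩
      map_add' := fun γ η ↦ by
        ext t
        exact intervalIntegral.integral_add
          ((γ.continuous.comp continuous_projIcc).intervalIntegrable _ _)
          ((η.continuous.comp continuous_projIcc).intervalIntegrable _ _)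
      map_smul' := fun c γ ↦ by
        ext t
        exact intervalIntegral.integral_smul c _ } 1
    (fun γ ↦ by
      refine (ContinuousMap.norm_le _ (by positivity)).2 fun t ↦ ?_
      refine (intervalIntegral.norm_integral_le_of_norm_le_const
        (C := ‖γ‖) fun s _ ↦ γ.norm_coe_le_norm _).trans ?_
      rw [sub_zero, abs_of_nonneg t.2.1, mul_comm]
      exact mul_le_mul_of_nonneg_right t.2.2 (norm_nonneg _))

variable {V}

end Volterra

/-! ### The Picard operator along rays and its linearisation -/

section TotalDifferentialEquation

lemma hasFDerivAt_comp_continuousMap_apply {K : Type*} [TopologicalSpace K] [CompactSpace K]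
    {Z Y : Type*} [NormedAddCommGroup Z] [NormedSpace ℝ Z] [NormedAddCommGroup Y] [NormedSpace ℝ Y]
    (f : C(Z, Y)) (hf : ContDiff ℝ ∞ f) (γ : C(K, Z)) :
    ∃ f' : C(K, Z) →L[ℝ] C(K, Y), HasFDerivAt (fun γ : C(K, Z) ↦ f.comp γ) f' γ ∧
      ∀ η s, f' η s = fderiv ℝ f (γ s) (η s) :=
  ⟨_, hasFDerivAt_comp_continuousMap (.id ℝ (Z →L[ℝ] Y)) (fun w ↦ le_rfl) f
    ⟨fderiv ℝ f, hf.continuous_fderiv (by simp)⟩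
    (fun z ↦ (hf.differentiable (by simp) z).hasFDerivAt) γ, fun _ _ ↦ rfl⟩

lemma hasFDerivAt_pointwiseApply_comp {K : Type*} [TopologicalSpace K] [CompactSpace K]
    {W Z Y X : Type*} [NormedAddCommGroup W] [NormedSpace ℝ W]
    [NormedAddCommGroup Z] [NormedSpace ℝ Z] [NormedAddCommGroup Y] [NormedSpace ℝ Y]
    [NormedAddCommGroup X] [NormedSpace ℝ X] (b : W →L[ℝ] Z →L[ℝ] Y)
    {g : X → C(K, W)} {g' : X →L[ℝ] C(K, W)} {x : X} (hg : HasFDerivAt g g' x) :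
    HasFDerivAt (fun x ↦ pointwiseApply K b (g x)) ((pointwiseApply K b).comp g') x :=
  (pointwiseApply K b).hasFDerivAt.comp x hg

/-- Constant maps, as a continuous linear map. -/
noncomputable def constCLM (K : Type*) [TopologicalSpace K] [CompactSpace K] (X : Type*)
    [NormedAddCommGroup X] [NormedSpace ℝ X] : X →L[ℝ] C(K, X) :=
  LinearMap.mkContinuous
    { toFun := ContinuousMap.const K
      map_add' := fun _ _ ↦ rfl
      map_smul' := fun _ _ ↦ rfl } 1
    (fun x ↦ (ContinuousMap.norm_le _ (by positivity)).2 fun _ ↦ (one_mul ‖x‖).ge)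

@[simp] lemma constCLM_apply {K : Type*} [TopologicalSpace K] [CompactSpace K] {X : Type*}
    [NormedAddCommGroup X] [NormedSpace ℝ X] (x : X) (s : K) : constCLM K X x s = x := rfl

variable {X V W : Type u} [NormedAddCommGroup X] [NormedSpace ℝ X]
  [NormedAddCommGroup V] [NormedSpace ℝ V] [NormedAddCommGroup W] [NormedSpace ℝ W]

variable (X V) in
/-- The path `s ↦ (s u, γ s)` over the ray through `u`. -/
noncomputable def rayLift :
    (X × V) × C(Icc (0 : ℝ) 1, V) →L[ℝ] C(Icc (0 : ℝ) 1, X × V) :=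
  LinearMap.mkContinuous
    { toFun := fun q ↦ ⟨fun s ↦ ((s : ℝ) • q.1.1, q.2 s), by fun_prop⟩
      map_add' := fun _ _ ↦ by ext <;> simp
      map_smul' := fun c q ↦ by ext <;> simp [smul_comm c] } 1
    (fun q ↦ by
      refine (ContinuousMap.norm_le _ (by positivity)).2 fun s ↦ ?_
      rw [one_mul]
      refine max_le ?_ ((q.2.norm_coe_le_norm s).trans (norm_snd_le q))
      change ‖(s : ℝ) • q.1.1‖ ≤ _
      rw [norm_smul, Real.norm_eq_abs, abs_of_nonneg s.2.1]
      calc (s : ℝ) * ‖q.1.1‖ ≤ 1 * ‖q.1.1‖ := by gcongr; exact s.2.2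
        _ ≤ ‖q‖ := by rw [one_mul]; exact (norm_fst_le q.1).trans (norm_fst_le q))

@[simp] lemma rayLift_apply (q : (X × V) × C(Icc (0 : ℝ) 1, V)) (s : Icc (0 : ℝ) 1) :
    rayLift X V q s = ((s : ℝ) • q.1.1, q.2 s) := rfl

/-- The Picard operator of the total differential equation `D_u v = F (u, v)` along rays. -/
noncomputable def rayPicard (b : W →L[ℝ] X →L[ℝ] V) (F : C(X × V, W))
    (q : (X × V) × C(Icc (0 : ℝ) 1, V)) : C(Icc (0 : ℝ) 1, V) :=
  volterra V (pointwiseApply _ b (F.comp (rayLift X V q)) (constCLM _ X q.1.1))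

lemma contDiff_rayPicard (b : W →L[ℝ] X →L[ℝ] V) {F : C(X × V, W)} (hF : ContDiff ℝ ∞ F) :
    ContDiff ℝ ∞ (rayPicard b F) := by
  have h1 : ContDiff ℝ ∞ (fun γ : C(Icc (0 : ℝ) 1, X × V) ↦ F.comp γ) :=
    contDiff_infty.2 fun n ↦ contDiff_comp_continuousMap n F (hF.of_le (by exact_mod_cast le_top))
  have h2 := contDiff_pointwiseApply_comp b (h1.comp (rayLift X V).contDiff)
  have h3 : ContDiff ℝ ∞ (fun q : (X × V) × C(Icc (0 : ℝ) 1, V) ↦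
      constCLM (Icc (0 : ℝ) 1) X q.1.1) :=

    (constCLM (Icc (0 : ℝ) 1) X).contDiff.comp
      (f := fun q : (X × V) × C(Icc (0 : ℝ) 1, V) ↦ q.1.1) (contDiff_fst.comp contDiff_fst)
  exact (volterra V).contDiff.comp (h2.clm_apply h3)

/-- Product rule for the integrand `b (F (s u, γ s)) u`: one summand varies the factor `u`, the
other the path. The second vanishes when `u = 0`, which makes the inverse function theorem
applicable there. -/
lemma fderiv_rayPicard (b : W →L[ℝ] X →L[ℝ] V) {F : C(X × V, W)} (hF : ContDiff ℝ ∞ F)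
    (q q' : (X × V) × C(Icc (0 : ℝ) 1, V)) (t : Icc (0 : ℝ) 1) :
    fderiv ℝ (rayPicard b F) q q' t = ∫ s in (0 : ℝ)..t,
      (b (F (rayLift X V q (projIcc 0 1 zero_le_one s))) q'.1.1 +
        b (fderiv ℝ F (rayLift X V q (projIcc 0 1 zero_le_one s))
          (rayLift X V q' (projIcc 0 1 zero_le_one s))) q.1.1) := by
  obtain ⟨F', hF', hF'a⟩ := hasFDerivAt_comp_continuousMap_apply F hF (rayLift X V q)
  have h0 : HasFDerivAt (fun q ↦ F.comp (rayLift X V q)) (F' ∘L rayLift X V) q :=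
    hF'.comp q (rayLift X V).hasFDerivAt
  have h1 := hasFDerivAt_pointwiseApply_comp b h0
  have h2 := ((constCLM (Icc (0 : ℝ) 1) X).hasFDerivAt (x := q.1.1)).comp q
    ((hasFDerivAt_fst (𝕜 := ℝ) (p := q.1)).comp q (hasFDerivAt_fst (𝕜 := ℝ) (p := q)))
  have h3 := (volterra V).hasFDerivAt.comp q (h1.clm_apply h2)
  rw [HasFDerivAt.fderiv (f := rayPicard b F) h3]
  have h4 : ∀ s, (F' (rayLift X V q')) s = fderiv ℝ F (rayLift X V q s) (rayLift X V q' s) :=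
    fun s ↦ hF'a _ s
  change (∫ s in (0 : ℝ)..t, (b (F (rayLift X V q (projIcc 0 1 zero_le_one s))) q'.1.1 +
    b (F' (rayLift X V q') (projIcc 0 1 zero_le_one s)) q.1.1)) = _
  simp only [h4]

/-- The derivative in the direction of `u` of a solution over the ray through `u`. -/
lemma fderiv_rayPicard_eq_of_integrable (b : W →L[ℝ] X →L[ℝ] V) [CompleteSpace V]
    {F : C(X × V, W)} (hF : ContDiff ℝ ∞ F)
    {S : Set (X × V)} (hint : ∀ z ∈ S, ∀ a c,
      b (fderiv ℝ F z (a, b (F z) a)) c = b (fderiv ℝ F z (c, b (F z) c)) a)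
    {u : X} {v : V} {γ : C(Icc (0 : ℝ) 1, V)} (hS : ∀ s, rayLift X V ((u, v), γ) s ∈ S)
    (hγ : γ = constCLM _ V v + rayPicard b F ((u, v), γ)) (a : X) (κ : C(Icc (0 : ℝ) 1, V))
    (hκ : ∀ s, κ s = (s : ℝ) • b (F (rayLift X V ((u, v), γ) s)) a) :
    fderiv ℝ (rayPicard b F) ((u, v), γ) ((a, 0), κ) = κ := by
  -- `g` extends the path `γ` to the whole line, so that it has two-sided derivatives at the end
  -- points as well.
  set g : ℝ → V := fun t ↦ v + ∫ s in (0 : ℝ)..t,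
    b (F (rayLift X V ((u, v), γ) (projIcc 0 1 zero_le_one s))) u
  have hgγ : ∀ t : Icc (0 : ℝ) 1, g t = γ t := by
    intro t
    conv_rhs => rw [hγ]
    rfl
  have hcont : Continuous fun s : ℝ ↦
      b (F (rayLift X V ((u, v), γ) (projIcc 0 1 zero_le_one s))) u := by
    have : Continuous (projIcc (0 : ℝ) 1 zero_le_one) := continuous_projIcc
    have h2 := (F.continuous.comp (rayLift X V ((u, v), γ)).continuous).comp this
    exact (b.continuous.comp h2).clm_apply continuous_const
  have hgd : ∀ t, HasDerivAt g (b (F (rayLift X V ((u, v), γ) (projIcc 0 1 zero_le_one t))) u) t :=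
    fun t ↦ (intervalIntegral.integral_hasDerivAt_right (hcont.intervalIntegrable _ _)
      hcont.aestronglyMeasurable.stronglyMeasurableAtFilter hcont.continuousAt).const_add v
  have hpt : ∀ s ∈ Icc (0 : ℝ) 1, rayLift X V ((u, v), γ) (projIcc 0 1 zero_le_one s)
      = (s • u, g s) := by
    intro s hs
    rw [projIcc_of_mem zero_le_one hs, rayLift_apply, ← hgγ]
  ext t
  rw [fderiv_rayPicard b hF, hκ]
  -- With `F a` short for `b (F ·) a`, integrability gives `k' = F a + s DF(u, F u) a = F a + s
  -- DF(a, F a) u`. This is the integrand of the linearised operator at `((a, 0), κ)`, and `k 0 =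
  -- 0`.
  set k : ℝ → V := fun s ↦ s • b (F (s • u, g s)) a
  have hk : ∀ s ∈ uIcc 0 (t : ℝ), HasDerivAt k
      (b (F (rayLift X V ((u, v), γ) (projIcc 0 1 zero_le_one s))) a +
        b (fderiv ℝ F (rayLift X V ((u, v), γ) (projIcc 0 1 zero_le_one s))
          (rayLift X V ((a, 0), κ) (projIcc 0 1 zero_le_one s))) u) s := by
    intro s hs
    rw [uIcc_of_le t.2.1] at hs
    have hs1 : s ∈ Icc (0 : ℝ) 1 := ⟨hs.1, hs.2.trans t.2.2⟩
    have hzS := hS (projIcc 0 1 zero_le_one s)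
    have hg := hgd s
    rw [rayLift_apply ((a, 0), κ), hκ]
    rw [hpt s hs1] at hzS hg ⊢
    rw [projIcc_of_mem zero_le_one hs1]
    have h1 : HasDerivAt (fun s : ℝ ↦ (s • u, g s)) ((1 : ℝ) • u, b (F (s • u, g s)) u) s :=
      ((hasDerivAt_id s).smul_const u).prodMk hg
    have h2 : HasDerivAt (fun s : ℝ ↦ F (s • u, g s))
        (fderiv ℝ F (s • u, g s) ((1 : ℝ) • u, b (F (s • u, g s)) u)) s :=
      ((hF.differentiable (by simp) (s • u, g s)).hasFDerivAt).comp_hasDerivAt s h1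
    have h3 : HasDerivAt (fun s : ℝ ↦ b (F (s • u, g s)) a)
        (b (fderiv ℝ F (s • u, g s) ((1 : ℝ) • u, b (F (s • u, g s)) u)) a) s :=
      ((b.flip a).hasFDerivAt).comp_hasDerivAt s h2
    have h4 := (hasDerivAt_id s).smul h3
    refine h4.congr_deriv ?_
    rw [one_smul, hint _ hzS u a, one_smul, add_comm]
    congr 1
    have : ((s • a, s • b (F (s • u, g s)) a) : X × V) = s • (a, b (F (s • u, g s)) a) := rfl
    rw [this, map_smul, map_smul, smul_apply]
    rfl
  have hc2 : Continuous fun s : ℝ ↦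
      (b (F (rayLift X V ((u, v), γ) (projIcc 0 1 zero_le_one s))) a +
        b (fderiv ℝ F (rayLift X V ((u, v), γ) (projIcc 0 1 zero_le_one s))
          (rayLift X V ((a, 0), κ) (projIcc 0 1 zero_le_one s))) u) := by
    have hp : Continuous (projIcc (0 : ℝ) 1 zero_le_one) := continuous_projIcc
    have h1 := (rayLift X V ((u, v), γ)).continuous.comp hp
    have h2 := (rayLift X V ((a, 0), κ)).continuous.comp hp
    have h3 := F.continuous.comp h1
    have h4 := (hF.continuous_fderiv (by simp)).comp h1
    exact ((b.continuous.comp h3).clm_apply continuous_const).add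
      ((b.continuous.comp (h4.clm_apply h2)).clm_apply continuous_const)
  rw [intervalIntegral.integral_eq_sub_of_hasDerivAt hk (hc2.intervalIntegrable _ _)]
  have h0 := hpt t t.2
  rw [projIcc_of_mem zero_le_one t.2] at h0
  rw [h0]
  simp [k]

end TotalDifferentialEquation

/-! ### Frobenius' theorem for total differential equations -/

section TotalDifferentialEquationSolution

variable {X V W : Type u} [NormedAddCommGroup X] [NormedSpace ℝ X]
  [NormedAddCommGroup V] [NormedSpace ℝ V] [NormedAddCommGroup W] [NormedSpace ℝ W]

lemma rayPicard_zero_left (b : W →L[ℝ] X →L[ℝ] V) (F : C(X × V, W)) (v : V)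
    (γ : C(Icc (0 : ℝ) 1, V)) : rayPicard b F ((0, v), γ) = 0 := by
  simp [rayPicard]

/-- Frobenius' theorem for a total differential equation `D_u G = F (u, G)` with globally defined
smooth right hand side that is integrable on an open set. -/
theorem exists_solution_totalDifferentialEquation [CompleteSpace X] [CompleteSpace V]
    (b : W →L[ℝ] X →L[ℝ] V) {F : C(X × V, W)} (hF : ContDiff ℝ ∞ F)
    {S : Set (X × V)} (hS : IsOpen S) (hint : ∀ z ∈ S, ∀ a c,
      b (fderiv ℝ F z (a, b (F z) a)) c = b (fderiv ℝ F z (c, b (F z) c)) a)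
    {v₀ : V} (h₀ : (0, v₀) ∈ S) :
    ∃ (O : Set (X × V)) (G : X × V → V), IsOpen O ∧ (0, v₀) ∈ O ∧ ContDiffOn ℝ ∞ G O ∧
      (∀ v, (0, v) ∈ O → G (0, v) = v) ∧
      ∀ p ∈ O, (p.1, G p) ∈ S ∧ ∀ a, fderiv ℝ G p (a, 0) = b (F (p.1, G p)) a := by
  set Q := (X × V) × C(Icc (0 : ℝ) 1, V)
  set cV := constCLM (Icc (0 : ℝ) 1) V
  -- The second component vanishes exactly at solutions of the integral equation over a ray.
  -- Carrying the parameters `(u, v)` along in the first component turns an implicit function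
  -- problem into an inverse function problem.
  set H : Q → Q := fun q ↦ (q.1, q.2 - (cV q.1.2 + rayPicard b F q))
  have hR := contDiff_rayPicard b hF
  have hH : ContDiff ℝ ∞ H :=
    contDiff_fst.prodMk (contDiff_snd.sub
      ((cV.contDiff.comp (contDiff_snd.comp contDiff_fst)).add hR))
  have hHd : ∀ q : Q, HasFDerivAt H ((ContinuousLinearMap.fst ℝ _ _).prod
      (ContinuousLinearMap.snd ℝ _ _ - (cV ∘L (ContinuousLinearMap.snd ℝ _ _ ∘L
        ContinuousLinearMap.fst ℝ _ _) + fderiv ℝ (rayPicard b F) q))) q := fun q ↦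
    hasFDerivAt_fst.prodMk (hasFDerivAt_snd.sub
      ((cV.hasFDerivAt.comp q (hasFDerivAt_snd.comp q hasFDerivAt_fst)).add
        (hR.differentiable (by simp) q).hasFDerivAt))
  set q₀ : Q := ((0, v₀), cV v₀)
  set T := fderiv ℝ (rayPicard b F) q₀ with hT
  -- At `u = 0` the variation of the path is multiplied by `u` and drops out. Hence the derivative
  -- of `H` at `q₀` is unitriangular, with the explicit inverse used in `L`.
  have hTz : ∀ p γ, T (p, γ) = T (p, 0) := by
    intro p γ
    ext t
    rw [hT, fderiv_rayPicard b hF, fderiv_rayPicard b hF]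
    simp [q₀]
  set L : Q ≃L[ℝ] Q := ContinuousLinearEquiv.equivOfInverse
    ((ContinuousLinearMap.fst ℝ _ _).prod
      (ContinuousLinearMap.snd ℝ _ _ - (cV ∘L (ContinuousLinearMap.snd ℝ _ _ ∘L
        ContinuousLinearMap.fst ℝ _ _) + T)))
    ((ContinuousLinearMap.fst ℝ _ _).prod
      (ContinuousLinearMap.snd ℝ _ _ + (cV ∘L (ContinuousLinearMap.snd ℝ _ _ ∘L
        ContinuousLinearMap.fst ℝ _ _) + T ∘L (ContinuousLinearMap.inl ℝ _ _ ∘L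
          ContinuousLinearMap.fst ℝ _ _))))
    (fun q ↦ by
      refine Prod.ext rfl ?_
      change (q.2 - (cV q.1.2 + T (q.1, q.2))) + (cV q.1.2 + T (q.1, 0)) = q.2
      rw [hTz q.1 q.2]; abel)
    (fun q ↦ by
      refine Prod.ext rfl ?_
      change (q.2 + (cV q.1.2 + T (q.1, 0))) - (cV q.1.2 + T (q.1, q.2 + _)) = q.2
      rw [hTz q.1 (q.2 + _)]; abel)
  obtain ⟨e, heq₀, -, he, hes, hed⟩ := exists_smooth_openPartialHomeomorph isOpen_univ
    hH.contDiffOn (mem_univ q₀) L (hHd q₀)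
  -- The lifted path must stay in `S`, where integrability is known; this is an open condition
  -- because the interval is compact.
  set A : Set Q := {q | ∀ s, rayLift X V q s ∈ S}
  have hA : IsOpen A := by
    have h1 : IsOpen {f : C(Icc (0 : ℝ) 1, X × V) | MapsTo f univ S} :=
      ContinuousMap.isOpen_setOfPred_mapsTo isCompact_univ hS
    have h2 : A = rayLift X V ⁻¹' {f : C(Icc (0 : ℝ) 1, X × V) | MapsTo f univ S} :=
      Set.ext fun q ↦ ⟨fun h s _ ↦ h s, fun h s ↦ h (mem_univ s)⟩
    exact h2 ▸ h1.preimage (rayLift X V).continuous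
  set ι : X × V → Q := fun p ↦ (p, 0)
  set O : Set (X × V) := ι ⁻¹' (e.target ∩ e.symm ⁻¹' A)
  have hO : IsOpen O := (e.symm.isOpen_inter_preimage hA).preimage (by fun_prop)
  set Γ : X × V → C(Icc (0 : ℝ) 1, V) := fun p ↦ (e.symm (p, 0)).2
  have hsymm : ∀ p ∈ O, e.symm (p, 0) = (p, Γ p) ∧ Γ p = cV p.2 + rayPicard b F (p, Γ p) := by
    intro p hp
    have h1 := e.right_inv hp.1
    rw [he] at h1
    have h2 : (e.symm (p, 0)).1 = p := congrArg Prod.fst h1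
    have h3 : e.symm (p, 0) = (p, Γ p) := Prod.ext h2 rfl
    refine ⟨h3, ?_⟩
    have h4 := congrArg Prod.snd h1
    simp only [ι, h3, H] at h4
    exact sub_eq_zero.1 h4
  have hq₀ : e q₀ = ι (0, v₀) := by
    rw [he]
    simp [H, q₀, ι, rayPicard_zero_left]
  have h₀O : (0, v₀) ∈ O := by
    refine ⟨hq₀ ▸ e.map_source heq₀, ?_⟩
    rw [mem_preimage, ← hq₀, e.left_inv heq₀]
    intro s
    simpa [q₀, cV] using h₀
  have hΓ : ContDiffOn ℝ ∞ Γ O := by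
    have h1 : ContDiffOn ℝ ∞ (fun p : X × V ↦ e.symm (p, 0)) O :=
      hes.comp (contDiff_id.prodMk contDiff_const).contDiffOn fun p hp ↦ hp.1
    exact contDiff_snd.comp_contDiffOn h1
  set ev : C(Icc (0 : ℝ) 1, V) →L[ℝ] V := ContinuousMap.evalCLM ℝ (1 : Icc (0 : ℝ) 1)
  refine ⟨O, fun p ↦ ev (Γ p), hO, h₀O, ev.contDiff.comp_contDiffOn hΓ, fun v hv ↦ ?_,
    fun p hp ↦ ⟨?_, fun a ↦ ?_⟩⟩
  · change ev (Γ (0, v)) = v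
    rw [(hsymm _ hv).2, rayPicard_zero_left]
    simp [ev, cV]
  · have := hp.2
    rw [mem_preimage, (hsymm p hp).1] at this
    simpa [ev] using this 1
  · have hd : HasFDerivAt Γ (fderiv ℝ Γ p) p :=
      ((hΓ.contDiffAt (hO.mem_nhds hp)).differentiableAt (by simp)).hasFDerivAt
    have hd2 : HasFDerivAt (fun p ↦ H (p, Γ p)) _ p :=
      (hHd (p, Γ p)).comp p ((hasFDerivAt_id p).prodMk hd)
    have hd3 : HasFDerivAt (fun p ↦ H (p, Γ p)) (ContinuousLinearMap.inl ℝ _ _) p := by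
      refine (ContinuousLinearMap.hasFDerivAt
        (ContinuousLinearMap.inl ℝ (X × V) (C(Icc (0 : ℝ) 1, V)))).congr_of_eventuallyEq ?_
      filter_upwards [hO.mem_nhds hp] with p' hp'
      refine Prod.ext rfl ?_
      exact sub_eq_zero.2 (hsymm p' hp').2
    have h5 := congrArg Prod.snd (DFunLike.congr_fun (hd2.unique hd3) (a, 0))
    change fderiv ℝ Γ p (a, 0) - (cV 0 + fderiv ℝ (rayPicard b F) (p, Γ p)
      ((a, 0), fderiv ℝ Γ p (a, 0))) = 0 at h5
    rw [map_zero, zero_add, sub_eq_zero] at h5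
    -- The candidate for the derivative of `Γ` in the direction `(a, 0)`. Both satisfy the same
    -- linearised equation, and the derivative of `H` is injective at every point of `e.source`, so
    -- they agree. At `s = 1` this is the differential equation for `G`.
    set κ : C(Icc (0 : ℝ) 1, V) := ⟨fun s ↦ (s : ℝ) • b (F (rayLift X V (p, Γ p) s)) a, by
      have h1 := F.continuous.comp (rayLift X V (p, Γ p)).continuous
      exact continuous_subtype_val.smul ((b.continuous.comp h1).clm_apply continuous_const)⟩
    have hmemA : ∀ s, rayLift X V (p, Γ p) s ∈ S := by
      have := hp.2
      rwa [mem_preimage, (hsymm p hp).1] at this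
    have hκ : fderiv ℝ (rayPicard b F) (p, Γ p) ((a, 0), κ) = κ :=
      fderiv_rayPicard_eq_of_integrable b hF hint (u := p.1) (v := p.2) hmemA (hsymm p hp).2 a κ
        fun s ↦ rfl
    obtain ⟨L', hL'⟩ := hed (e.symm (p, 0)) (e.map_target hp.1)
    rw [(hsymm p hp).1] at hL'
    have h6 : L' ((0 : X × V), fderiv ℝ Γ p (a, 0) - κ) = 0 := by
      have h7 := DFunLike.congr_fun (hL'.unique (hHd (p, Γ p)))
        ((0 : X × V), fderiv ℝ Γ p (a, 0) - κ)
      refine h7.trans (Prod.ext rfl ?_)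
      change (fderiv ℝ Γ p (a, 0) - κ) - (cV 0 + fderiv ℝ (rayPicard b F) (p, Γ p)
        ((0 : X × V), fderiv ℝ Γ p (a, 0) - κ)) = 0
      have h8 : (((0 : X × V), fderiv ℝ Γ p (a, 0) - κ) : Q) =
          ((a, 0), fderiv ℝ Γ p (a, 0)) - ((a, 0), κ) := by
        refine Prod.ext ?_ rfl
        simp
      rw [h8, map_sub, ← h5, hκ, map_zero, zero_add, sub_self]
    have h9 : fderiv ℝ Γ p (a, 0) = κ := by
      have := (map_eq_zero_iff L' L'.injective).1 h6
      exact sub_eq_zero.1 (congrArg Prod.snd this)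
    have h10 : HasFDerivAt (fun p ↦ ev (Γ p)) (ev ∘L fderiv ℝ Γ p) p := ev.hasFDerivAt.comp p hd
    rw [h10.fderiv]
    change ev (fderiv ℝ Γ p (a, 0)) = _
    rw [h9]
    change ((1 : Icc (0 : ℝ) 1) : ℝ) • b (F (rayLift X V (p, Γ p) 1)) a = _
    simp [ev]

/-- Frobenius' theorem for a total differential equation `D_u G = F (u, G)`. -/
theorem exists_solution_totalDifferentialEquation_of_contDiffOn [FiniteDimensional ℝ X]
    [FiniteDimensional ℝ V] {F : X × V → X →L[ℝ] V} {S : Set (X × V)} (hS : IsOpen S)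
    (hF : ContDiffOn ℝ ∞ F S)
    (hint : ∀ z ∈ S, ∀ a c, fderiv ℝ F z (a, F z a) c = fderiv ℝ F z (c, F z c) a)
    {v₀ : V} (h₀ : (0, v₀) ∈ S) :
    ∃ (O : Set (X × V)) (G : X × V → V), IsOpen O ∧ (0, v₀) ∈ O ∧ ContDiffOn ℝ ∞ G O ∧
      (∀ v, (0, v) ∈ O → G (0, v) = v) ∧
      ∀ p ∈ O, (p.1, G p) ∈ S ∧ ∀ a, fderiv ℝ G p (a, 0) = F (p.1, G p) a := by
  have : CompleteSpace X := FiniteDimensional.complete ℝ X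
  have : CompleteSpace V := FiniteDimensional.complete ℝ V
  obtain ⟨r, hr, hrS⟩ := Metric.nhds_basis_closedBall.mem_iff.1 (hS.mem_nhds h₀)
  -- The cut-off makes the right hand side smooth everywhere but may spoil integrability where `χ`
  -- is not locally constant. On the ball of radius `r / 2` it equals `1`, and the solution is kept
  -- inside that ball.
  let χ : ContDiffBump ((0, v₀) : X × V) := ⟨r / 2, r, by positivity, by linarith⟩
  set F' : X × V → X →L[ℝ] V := fun z ↦ χ z • F z
  have hF' : ContDiff ℝ ∞ F' := by
    rw [contDiff_iff_contDiffAt]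
    intro z
    by_cases hz : z ∈ S
    · exact χ.contDiff.contDiffAt.smul (hF.contDiffAt (hS.mem_nhds hz))
    · have h1 : z ∈ (Metric.closedBall ((0, v₀) : X × V) r)ᶜ := fun h ↦ hz (hrS h)
      refine (contDiffAt_const (c := 0)).congr_of_eventuallyEq ?_
      filter_upwards [Metric.isClosed_closedBall.isOpen_compl.mem_nhds h1] with y hy
      have : χ y = 0 := χ.zero_of_le_dist (by
        simp only [mem_compl_iff, Metric.mem_closedBall, not_le] at hy
        exact hy.le)
      simp [F', this]
  have hbS : Metric.ball ((0, v₀) : X × V) (r / 2) ⊆ S := fun z hz ↦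
    hrS (Metric.mem_closedBall.2 ((Metric.mem_ball.1 hz).le.trans (by linarith)))
  have hEq : ∀ z ∈ Metric.ball ((0, v₀) : X × V) (r / 2), F' z = F z := by
    intro z hz
    simp [F', χ.one_of_mem_closedBall (Metric.ball_subset_closedBall hz)]
  obtain ⟨O, G, hO, h1, h2, h3, h4⟩ := exists_solution_totalDifferentialEquation
    (.id ℝ (X →L[ℝ] V)) (F := ⟨F', hF'.continuous⟩) hF'
    (S := Metric.ball ((0, v₀) : X × V) (r / 2)) Metric.isOpen_ball
    (fun z hz a c ↦ by
      have : F' =ᶠ[𝓝 z] F := by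
        filter_upwards [Metric.isOpen_ball.mem_nhds hz] with y hy using hEq y hy
      change fderiv ℝ F' z (a, F' z a) c = fderiv ℝ F' z (c, F' z c) a
      rw [this.fderiv_eq, hEq z hz]
      exact hint z (hbS hz) a c)
    (Metric.mem_ball_self (by positivity))
  refine ⟨O, G, hO, h1, h2, h3, fun p hp ↦ ⟨hbS (h4 p hp).1, fun a ↦ ?_⟩⟩
  rw [(h4 p hp).2 a, ← hEq _ (h4 p hp).1]
  rfl

end TotalDifferentialEquationSolution

/-! ### Leaves, parallel coframes and affine coordinates in a vector space -/

section AffineNormalForm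

variable {X Y : Type u} [NormedAddCommGroup X] [NormedSpace ℝ X]
  [NormedAddCommGroup Y] [NormedSpace ℝ Y]

/-- The right hand side of the total differential equation for the leaves `w`, a parallel coframe
`θ` and affine coordinates `x`, as functions of `u`. -/
noncomputable def affineRHS (A : X × Y → X →L[ℝ] Y) (Γ : X × Y → X →L[ℝ] X →L[ℝ] X)
    (z : X × (Y × (X →L[ℝ] X) × X)) : X →L[ℝ] Y × (X →L[ℝ] X) × X :=
  (A (z.1, z.2.1)).prod ((ContinuousLinearMap.compL ℝ X X X z.2.2.1 ∘L Γ (z.1, z.2.1)).prod z.2.2.1)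

lemma affineRHS_apply (A : X × Y → X →L[ℝ] Y) (Γ : X × Y → X →L[ℝ] X →L[ℝ] X)
    (z : X × (Y × (X →L[ℝ] X) × X)) (a : X) :
    affineRHS A Γ z a = (A (z.1, z.2.1) a, z.2.2.1 ∘L Γ (z.1, z.2.1) a, z.2.2.1 a) := rfl

lemma contDiffOn_clm_prod {Z E F G : Type*} [NormedAddCommGroup Z] [NormedSpace ℝ Z]
    [NormedAddCommGroup E] [NormedSpace ℝ E] [NormedAddCommGroup F] [NormedSpace ℝ F]
    [NormedAddCommGroup G] [NormedSpace ℝ G] {n : WithTop ℕ∞} {f : Z → E →L[ℝ] F}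
    {g : Z → E →L[ℝ] G} {s : Set Z} (hf : ContDiffOn ℝ n f s) (hg : ContDiffOn ℝ n g s) :
    ContDiffOn ℝ n (fun z ↦ (f z).prod (g z)) s :=
  (ContinuousLinearMap.prodₗᵢ ℝ : (E →L[ℝ] F) × (E →L[ℝ] G) ≃ₗᵢ[ℝ] _).contDiff.comp_contDiffOn
    (hf.prodMk hg)

lemma contDiffOn_affineRHS {A : X × Y → X →L[ℝ] Y} {Γ : X × Y → X →L[ℝ] X →L[ℝ] X}
    {S : Set (X × Y)} (hA : ContDiffOn ℝ ∞ A S) (hΓ : ContDiffOn ℝ ∞ Γ S) :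
    ContDiffOn ℝ ∞ (affineRHS A Γ) {z | (z.1, z.2.1) ∈ S} := by
  have hp : ContDiffOn ℝ ∞ (fun z : X × (Y × (X →L[ℝ] X) × X) ↦ (z.1, z.2.1))
    {z | (z.1, z.2.1) ∈ S} := ContDiff.contDiffOn (by fun_prop)
  have h1 := hA.comp hp (fun z hz ↦ hz)
  have h2 := hΓ.comp hp (fun z hz ↦ hz)
  have h3 : ContDiffOn ℝ ∞ (fun z : X × (Y × (X →L[ℝ] X) × X) ↦ z.2.2.1)
    {z | (z.1, z.2.1) ∈ S} := ContDiff.contDiffOn (by fun_prop)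
  have h4 := ((ContinuousLinearMap.compL ℝ X X X).contDiff.comp_contDiffOn h3).clm_comp h2
  exact contDiffOn_clm_prod h1 (contDiffOn_clm_prod h4 h3)

lemma fderiv_affineRHS_apply {A : X × Y → X →L[ℝ] Y} {Γ : X × Y → X →L[ℝ] X →L[ℝ] X}
    {z : X × (Y × (X →L[ℝ] X) × X)} (hF : DifferentiableAt ℝ (affineRHS A Γ) z)
    (hA : DifferentiableAt ℝ A (z.1, z.2.1)) (hΓ : DifferentiableAt ℝ Γ (z.1, z.2.1))
    (d : X × (Y × (X →L[ℝ] X) × X)) (c : X) :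
    fderiv ℝ (affineRHS A Γ) z d c = (fderiv ℝ A (z.1, z.2.1) (d.1, d.2.1) c,
      d.2.2.1 ∘L Γ (z.1, z.2.1) c + z.2.2.1 ∘L (fderiv ℝ Γ (z.1, z.2.1) (d.1, d.2.1) c),
      d.2.2.1 c) := by
  have h1 := (hF.hasFDerivAt.clm_apply (hasFDerivAt_const c z))
  set pr : X × (Y × (X →L[ℝ] X) × X) →L[ℝ] X × Y := (ContinuousLinearMap.fst ℝ _ _).prod
    (ContinuousLinearMap.fst ℝ _ _ ∘L ContinuousLinearMap.snd ℝ _ _)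
  set pt : X × (Y × (X →L[ℝ] X) × X) →L[ℝ] (X →L[ℝ] X) := ContinuousLinearMap.fst ℝ _ _ ∘L
    ContinuousLinearMap.snd ℝ _ _ ∘L ContinuousLinearMap.snd ℝ _ _
  have h2 := (HasFDerivAt.comp (g := A) z hA.hasFDerivAt pr.hasFDerivAt).clm_apply
    (hasFDerivAt_const c z)
  have h3 := (HasFDerivAt.comp (g := Γ) z hΓ.hasFDerivAt pr.hasFDerivAt).clm_apply
    (hasFDerivAt_const c z)
  have h4 := (pt.hasFDerivAt (x := z)).clm_comp h3
  have h5 := (pt.hasFDerivAt (x := z)).clm_apply (hasFDerivAt_const c z)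
  have h6 := DFunLike.congr_fun (h1.unique (h2.prodMk (h4.prodMk h5))) d
  simp only [ContinuousLinearMap.comp_zero, zero_add] at h6
  refine h6.trans (Prod.ext rfl (Prod.ext ?_ rfl))
  exact add_comm _ _

/-- The compatibility condition splits into components: involutivity of the graph for the leaf,
flatness for the coframe, and symmetry of the Christoffel symbols for the affine coordinates. -/
lemma affineRHS_integrable {A : X × Y → X →L[ℝ] Y} {Γ : X × Y → X →L[ℝ] X →L[ℝ] X}
    {S : Set (X × Y)} (hS : IsOpen S) (hA : ContDiffOn ℝ ∞ A S) (hΓ : ContDiffOn ℝ ∞ Γ S)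
    (hinv : ∀ z ∈ S, ∀ a c, fderiv ℝ A z (a, A z a) c = fderiv ℝ A z (c, A z c) a)
    (htor : ∀ z ∈ S, ∀ a c, Γ z a c = Γ z c a)
    (hflat : ∀ z ∈ S, ∀ a c v, fderiv ℝ Γ z (a, A z a) c v + Γ z a (Γ z c v) =
      fderiv ℝ Γ z (c, A z c) a v + Γ z c (Γ z a v))
    (z : X × (Y × (X →L[ℝ] X) × X)) (hz : (z.1, z.2.1) ∈ S) (a c : X) :
    fderiv ℝ (affineRHS A Γ) z (a, affineRHS A Γ z a) c =
      fderiv ℝ (affineRHS A Γ) z (c, affineRHS A Γ z c) a := by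
  have hd1 := (hA.contDiffAt (hS.mem_nhds hz)).differentiableAt (by simp)
  have hd2 := (hΓ.contDiffAt (hS.mem_nhds hz)).differentiableAt (by simp)
  have hS' : IsOpen {z : X × (Y × (X →L[ℝ] X) × X) | (z.1, z.2.1) ∈ S} :=
    hS.preimage (by fun_prop)
  have hd3 := ((contDiffOn_affineRHS hA hΓ).contDiffAt (hS'.mem_nhds hz)).differentiableAt (by simp)
  rw [fderiv_affineRHS_apply hd3 hd1 hd2, fderiv_affineRHS_apply hd3 hd1 hd2]
  simp only [affineRHS_apply]
  refine Prod.ext (hinv _ hz a c) (Prod.ext ?_ ?_)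
  · ext v
    simp only [add_apply, ContinuousLinearMap.comp_apply, ← map_add]
    rw [add_comm, hflat _ hz a c v, add_comm]
  · simp only [ContinuousLinearMap.comp_apply]
    rw [htor _ hz a c]

/-- A foliation, given by the graph of `A`, with a flat torsion-free connection along it, given by
the Christoffel symbols `Γ`, has local coordinates `φ = (x, y)` adapted to both: `y` is constant
along the leaves, and the restriction `θ` of `dx` to the leaves is parallel. -/
theorem exists_affine_foliation_coordinates [FiniteDimensional ℝ X] [FiniteDimensional ℝ Y]
    {A : X × Y → X →L[ℝ] Y} {Γ : X × Y → X →L[ℝ] X →L[ℝ] X}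
    {S : Set (X × Y)} (hS : IsOpen S) (h₀ : 0 ∈ S)
    (hA : ContDiffOn ℝ ∞ A S) (hΓ : ContDiffOn ℝ ∞ Γ S)
    (hinv : ∀ z ∈ S, ∀ a c, fderiv ℝ A z (a, A z a) c = fderiv ℝ A z (c, A z c) a)
    (htor : ∀ z ∈ S, ∀ a c, Γ z a c = Γ z c a)
    (hflat : ∀ z ∈ S, ∀ a c v, fderiv ℝ Γ z (a, A z a) c v + Γ z a (Γ z c v) =
      fderiv ℝ Γ z (c, A z c) a v + Γ z c (Γ z a v)) :
    ∃ (φ : OpenPartialHomeomorph (X × Y) (X × Y)) (θ : X × Y → X →L[ℝ] X),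
      0 ∈ φ.source ∧ φ.source ⊆ S ∧ ContDiffOn ℝ ∞ φ φ.source ∧ ContDiffOn ℝ ∞ φ.symm φ.target ∧
      ContDiffOn ℝ ∞ θ φ.source ∧ ∀ z ∈ φ.source, ∀ a,
        fderiv ℝ φ z (a, A z a) = (θ z a, 0) ∧ fderiv ℝ θ z (a, A z a) = θ z ∘L Γ z a := by
  have : CompleteSpace X := FiniteDimensional.complete ℝ X
  have : CompleteSpace Y := FiniteDimensional.complete ℝ Y
  have hS' : IsOpen {z : X × (Y × (X →L[ℝ] X) × X) | (z.1, z.2.1) ∈ S} :=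
    hS.preimage (by fun_prop)
  obtain ⟨O', G, hO', h₀O', hG, hG0, hGd⟩ :=
    exists_solution_totalDifferentialEquation_of_contDiffOn hS' (contDiffOn_affineRHS hA hΓ)
      (affineRHS_integrable hS hA hΓ hinv htor hflat)
      (v₀ := ((0 : Y), ContinuousLinearMap.id ℝ X, (0 : X))) h₀
  -- Initial data over `u = 0`: the leaf through `(0, w)`, the identity coframe, and the origin as
  -- affine coordinate.
  set ι : X × Y → X × (Y × (X →L[ℝ] X) × X) := fun p ↦ (p.1, p.2, ContinuousLinearMap.id ℝ X, 0)
  have hι : ContDiff ℝ ∞ ι := by fun_prop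
  set O := ι ⁻¹' O'
  have hO : IsOpen O := hO'.preimage hι.continuous
  have h₀O : (0 : X × Y) ∈ O := h₀O'
  set g : X × Y → Y × (X →L[ℝ] X) × X := fun p ↦ G (ι p)
  have hg : ContDiffOn ℝ ∞ g O := hG.comp hι.contDiffOn fun p hp ↦ hp
  have hgd : ∀ p ∈ O, HasFDerivAt g (fderiv ℝ g p) p := fun p hp ↦
    ((hg.contDiffAt (hO.mem_nhds hp)).differentiableAt (by simp)).hasFDerivAt
  have hgS : ∀ p ∈ O, (p.1, (g p).1) ∈ S := fun p hp ↦ (hGd _ hp).1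
  have hgX : ∀ p ∈ O, ∀ a, fderiv ℝ g p (a, 0) = affineRHS A Γ (p.1, g p) a := by
    intro p hp a
    have h1 : HasFDerivAt ι ((ContinuousLinearMap.fst ℝ X Y).prod
        ((ContinuousLinearMap.snd ℝ X Y).prod 0)) p :=
      hasFDerivAt_fst.prodMk (hasFDerivAt_snd.prodMk (hasFDerivAt_const _ _))
    have h2 : HasFDerivAt G (fderiv ℝ G (ι p)) (ι p) :=
      ((hG.contDiffAt (hO'.mem_nhds hp)).differentiableAt (by simp)).hasFDerivAt
    have h3 : HasFDerivAt g _ p := h2.comp p h1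
    rw [h3.fderiv]
    exact (hGd _ hp).2 a
  have hgY : ∀ c, fderiv ℝ g 0 (0, c) = (c, 0, 0) := by
    intro c
    have h1 : HasFDerivAt (fun w : Y ↦ g (0, w)) _ 0 :=
      HasFDerivAt.comp (g := g) (f := fun w : Y ↦ ((0 : X), w)) 0 (hgd 0 h₀O)
        ((hasFDerivAt_const (0 : X) (0 : Y)).prodMk (hasFDerivAt_id (0 : Y)))
    have h2 : HasFDerivAt (fun w : Y ↦ g (0, w)) ((ContinuousLinearMap.id ℝ Y).prod 0) 0 := by
      have h3 : HasFDerivAt (fun w : Y ↦ (w, (ContinuousLinearMap.id ℝ X, (0 : X))))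
        ((ContinuousLinearMap.id ℝ Y).prod 0) 0 := (hasFDerivAt_id _).prodMk (hasFDerivAt_const _ _)
      refine h3.congr_of_eventuallyEq ?_
      have h4 : ∀ᶠ w : Y in 𝓝 0, ((0 : X), w) ∈ O :=
        (by fun_prop : Continuous fun w : Y ↦ ((0 : X), w)).continuousAt.eventually
          (hO.mem_nhds h₀O)
      filter_upwards [h4] with w hw using hG0 _ hw
    exact DFunLike.congr_fun (h1.unique h2) c
  have hg0 : g 0 = (0, ContinuousLinearMap.id ℝ X, 0) := hG0 _ h₀O'
  have hgXY : ∀ a c, fderiv ℝ g 0 (a, c) = (A 0 a + c, Γ 0 a, a) := by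
    intro a c
    have : ((a, c) : X × Y) = (a, 0) + (0, c) := by simp
    rw [this, map_add, hgX 0 h₀O, hgY, affineRHS_apply, hg0]
    simp only [Prod.mk_add_mk, add_zero]
    rfl
  -- `Ψ` sends `(u, w)` to the point over `u` of the leaf through `(0, w)`, and `Ξ` sends it to the
  -- affine coordinates and the leaf label of this point; the chart is `Ξ ∘ Ψ⁻¹`. At the origin the
  -- derivative of `Ψ` is a shear and that of `Ξ` is the identity.
  set Ψ : X × Y → X × Y := fun p ↦ (p.1, (g p).1)
  set Ξ : X × Y → X × Y := fun p ↦ ((g p).2.2, p.2)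
  have hΨ : ContDiffOn ℝ ∞ Ψ O := contDiff_fst.contDiffOn.prodMk hg.fst
  have hΞ : ContDiffOn ℝ ∞ Ξ O := hg.snd.snd.prodMk contDiff_snd.contDiffOn
  have hΨd : ∀ p ∈ O, HasFDerivAt Ψ ((ContinuousLinearMap.fst ℝ X Y).prod
      (ContinuousLinearMap.fst ℝ _ _ ∘L fderiv ℝ g p)) p := fun p hp ↦
    hasFDerivAt_fst.prodMk (hgd p hp).fst
  have hΞd : ∀ p ∈ O, HasFDerivAt Ξ ((ContinuousLinearMap.snd ℝ _ _ ∘L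
      ContinuousLinearMap.snd ℝ _ _ ∘L fderiv ℝ g p).prod (ContinuousLinearMap.snd ℝ X Y)) p :=
    fun p hp ↦ (hgd p hp).snd.snd.prodMk hasFDerivAt_snd
  have hΨL : HasFDerivAt Ψ ((ContinuousLinearEquiv.equivOfInverse
      ((ContinuousLinearMap.fst ℝ X Y).prod
        (A 0 ∘L ContinuousLinearMap.fst ℝ X Y + ContinuousLinearMap.snd ℝ X Y))
      ((ContinuousLinearMap.fst ℝ X Y).prod
        (ContinuousLinearMap.snd ℝ X Y - A 0 ∘L ContinuousLinearMap.fst ℝ X Y))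
      (fun q ↦ Prod.ext rfl (add_sub_cancel_left _ _))
      (fun q ↦ Prod.ext rfl (add_sub_cancel _ _)) : (X × Y) ≃L[ℝ] (X × Y)) :
        (X × Y) →L[ℝ] (X × Y)) 0 := by
    refine (hΨd 0 h₀O).congr_fderiv ?_
    refine ContinuousLinearMap.ext fun q ↦ Prod.ext rfl ?_
    change (fderiv ℝ g 0 (q.1, q.2)).1 = _
    rw [hgXY]
    rfl
  have hΞL : HasFDerivAt Ξ (ContinuousLinearEquiv.refl ℝ (X × Y) : (X × Y) →L[ℝ] (X × Y)) 0 := by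
    refine (hΞd 0 h₀O).congr_fderiv ?_
    refine ContinuousLinearMap.ext fun q ↦ Prod.ext ?_ rfl
    change (fderiv ℝ g 0 (q.1, q.2)).2.2 = _
    rw [hgXY]
    rfl
  obtain ⟨e₁, h₀e₁, he₁O, he₁, he₁s, he₁d⟩ :=
    exists_smooth_openPartialHomeomorph hO hΨ h₀O _ hΨL
  obtain ⟨e₂, h₀e₂, he₂O, he₂, he₂s, -⟩ :=
    exists_smooth_openPartialHomeomorph hO hΞ h₀O _ hΞL
  have hmem : ∀ z ∈ (e₁.symm.trans e₂).source, e₁.symm z ∈ e₁.source ∧ e₁.symm z ∈ O ∧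
      Ψ (e₁.symm z) = z := fun z hz ↦
    ⟨e₁.map_target hz.1, he₁O (e₁.map_target hz.1), (he₁ _).symm.trans (e₁.right_inv hz.1)⟩
  have hφ : ∀ z, (e₁.symm.trans e₂) z = Ξ (e₁.symm z) := fun z ↦ he₂ _
  have he₁s' : ContDiffOn ℝ ∞ e₁.symm (e₁.symm.trans e₂).source := he₁s.mono fun z hz ↦ hz.1
  have he₂s' : ContDiffOn ℝ ∞ e₂.symm (e₁.symm.trans e₂).target := he₂s.mono fun z hz ↦ hz.1
  -- `Ψ⁻¹` straightens the leaves: this is the derivative of `Ψ⁻¹ ∘ Ψ = id` in the direction `(a,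
  -- 0)`.
  have hinvd : ∀ z ∈ (e₁.symm.trans e₂).source, HasFDerivAt e₁.symm (fderiv ℝ e₁.symm z) z ∧
      ∀ a, fderiv ℝ e₁.symm z (a, A z a) = (a, 0) := by
    intro z hz
    obtain ⟨h1, h2, h3⟩ := hmem z hz
    have h4 : HasFDerivAt e₁.symm (fderiv ℝ e₁.symm z) z :=
      ((he₁s.contDiffAt (e₁.open_target.mem_nhds hz.1)).differentiableAt (by simp)).hasFDerivAt
    refine ⟨h4, fun a ↦ ?_⟩
    have h5 : HasFDerivAt (fun p ↦ e₁.symm (Ψ p)) _ (e₁.symm z) :=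
      HasFDerivAt.comp (g := e₁.symm) (g' := fderiv ℝ e₁.symm z) _ (by rwa [h3]) (hΨd _ h2)
    have h6 : HasFDerivAt (fun p ↦ e₁.symm (Ψ p)) (ContinuousLinearMap.id ℝ _) (e₁.symm z) := by
      refine (hasFDerivAt_id _).congr_of_eventuallyEq ?_
      filter_upwards [e₁.open_source.mem_nhds h1] with p hp
      rw [← he₁, e₁.left_inv hp, id]
    have h7 := DFunLike.congr_fun (h5.unique h6) (a, 0)
    change fderiv ℝ e₁.symm z (a, (fderiv ℝ g (e₁.symm z) (a, 0)).1) = (a, 0) at h7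
    rw [hgX _ h2] at h7
    change fderiv ℝ e₁.symm z (a, A (Ψ (e₁.symm z)) a) = (a, 0) at h7
    rwa [h3] at h7
  refine ⟨e₁.symm.trans e₂, fun z ↦ (g (e₁.symm z)).2.1, ⟨?_, ?_⟩, fun z hz ↦ ?_, ?_, ?_, ?_, ?_⟩
  · have : e₁ 0 = 0 := by
      rw [he₁]
      exact Prod.ext rfl (by simp [Ψ, hg0])
    exact this ▸ e₁.map_source h₀e₁
  · have : e₁ 0 = 0 := by
      rw [he₁]
      exact Prod.ext rfl (by simp [Ψ, hg0])
    have h2 : e₁.symm 0 = 0 := by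
      conv_lhs => rw [← this]
      exact e₁.left_inv h₀e₁
    change e₁.symm 0 ∈ e₂.source
    rwa [h2]
  · obtain ⟨h1, h2, h3⟩ := hmem z hz
    exact h3 ▸ hgS _ h2
  · exact (hΞ.comp he₁s' fun z hz ↦ (hmem z hz).2.1).congr fun z _ ↦ hφ z
  · refine (hΨ.comp he₂s' fun z hz ↦ he₁O hz.2).congr fun z _ ↦ he₁ _
  · exact (hg.comp he₁s' fun z hz ↦ (hmem z hz).2.1).snd.fst
  · intro z hz a
    obtain ⟨h1, h2, h3⟩ := hmem z hz
    obtain ⟨h4, h5⟩ := hinvd z hz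
    constructor
    · have h6 : HasFDerivAt (e₁.symm.trans e₂) _ z :=
        (HasFDerivAt.comp z (hΞd _ h2) h4).congr_of_eventuallyEq (Eventually.of_forall hφ)
      rw [h6.fderiv]
      change ((fderiv ℝ g (e₁.symm z) (fderiv ℝ e₁.symm z (a, A z a))).2.2,
        (fderiv ℝ e₁.symm z (a, A z a)).2) = _
      rw [h5, hgX _ h2]
      rfl
    · have h6 : HasFDerivAt (fun z ↦ (g (e₁.symm z)).2.1) _ z :=
        ((hgd _ h2).comp z h4).snd.fst
      rw [h6.fderiv]
      change (fderiv ℝ g (e₁.symm z) (fderiv ℝ e₁.symm z (a, A z a))).2.1 = _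
      rw [h5, hgX _ h2, affineRHS_apply]
      change _ ∘L Γ (Ψ (e₁.symm z)) a = _
      rw [h3]

end AffineNormalForm

/-! ### Differentials, smooth charts and Lie brackets on manifolds -/

lemma two_le_infty : (2 : WithTop ℕ∞) ≤ ∞ :=
  (WithTop.coe_le_coe (b := (2 : ℕ∞)) (a := ⊤)).2 le_top

section ManifoldToolkit

variable {E : Type*} [NormedAddCommGroup E] [NormedSpace ℝ E]
  {M : Type*} [TopologicalSpace M] [ChartedSpace E M]
  {F : Type*} [NormedAddCommGroup F] [NormedSpace ℝ F]

/-- The differential of a vector valued function. -/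
noncomputable def vdif (f : M → F) (q : M) : TangentSpace 𝓘(ℝ, E) q →L[ℝ] F :=
  mfderiv 𝓘(ℝ, E) 𝓘(ℝ, F) f q

variable (E) in
/-- `f` is differentiable at `q`, as a function on a manifold modelled on `E`. -/
def VDiffAt (f : M → F) (q : M) : Prop := MDifferentiableAt 𝓘(ℝ, E) 𝓘(ℝ, F) f q

variable (E) in
/-- `f` is smooth on `U`, as a function on a manifold modelled on `E`. -/
def VSmooth (U : Set M) (f : M → F) : Prop := ContMDiffOn 𝓘(ℝ, E) 𝓘(ℝ, F) ∞ f U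

/-- A chart that is smooth in both directions. -/
def IsSmoothChart (E : Type*) [NormedAddCommGroup E] [NormedSpace ℝ E] [ChartedSpace E M]
    (ψ : OpenPartialHomeomorph M F) : Prop :=
  ContMDiffOn 𝓘(ℝ, E) 𝓘(ℝ, F) ∞ ψ ψ.source ∧ ContMDiffOn 𝓘(ℝ, F) 𝓘(ℝ, E) ∞ ψ.symm ψ.target

lemma VSmooth.vdiffAt {U : Set M} {f : M → F} (hf : VSmooth E U f) (hU : IsOpen U) {q : M}
    (hq : q ∈ U) : VDiffAt E f q :=
  (hf.contMDiffAt (hU.mem_nhds hq)).mdifferentiableAt (by simp)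

lemma vdif_congr {f g : M → F} {q : M} (h : f =ᶠ[𝓝 q] g) : vdif (E := E) f q = vdif g q :=
  h.mfderiv_eq

lemma vdif_comp {G : Type*} [NormedAddCommGroup G] [NormedSpace ℝ G] {h : F → G} {f : M → F}
    {q : M} (hh : DifferentiableAt ℝ h (f q)) (hf : VDiffAt E f q)
    (v : TangentSpace 𝓘(ℝ, E) q) :
    vdif (fun q ↦ h (f q)) q v = fderiv ℝ h (f q) (vdif f q v) := by
  have h1 := mfderiv_comp q (I' := 𝓘(ℝ, F)) hh.mdifferentiableAt hf
  rw [mfderiv_eq_fderiv] at h1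
  exact DFunLike.congr_fun h1 v

lemma VSmooth.comp {G : Type*} [NormedAddCommGroup G] [NormedSpace ℝ G] {h : F → G} {f : M → F}
    {U : Set M} {s : Set F} (hh : ContDiffOn ℝ ∞ h s) (hf : VSmooth E U f) (hU : MapsTo f U s) :
    VSmooth E U (fun q ↦ h (f q)) :=
  ContMDiffOn.comp (I' := 𝓘(ℝ, F)) hh.contMDiffOn hf hU

lemma VSmooth.contDiffOn_symm {U : Set M} {f : M → F} (hf : VSmooth E U f) {G : Type*}
    [NormedAddCommGroup G] [NormedSpace ℝ G] {ψ : OpenPartialHomeomorph M G}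
    (hψ : IsSmoothChart E ψ) :
    ContDiffOn ℝ ∞ (fun z ↦ f (ψ.symm z)) (ψ.target ∩ ψ.symm ⁻¹' U) :=
  (ContMDiffOn.comp (I' := 𝓘(ℝ, E)) hf (hψ.2.mono inter_subset_left)
    fun _ hz ↦ hz.2).contDiffOn

lemma IsSmoothChart.mdifferentiable {ψ : OpenPartialHomeomorph M F} (hψ : IsSmoothChart E ψ) :
    ψ.MDifferentiable 𝓘(ℝ, E) 𝓘(ℝ, F) :=
  ⟨hψ.1.mdifferentiableOn (by simp), hψ.2.mdifferentiableOn (by simp)⟩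

lemma IsSmoothChart.vdiffAt {ψ : OpenPartialHomeomorph M F} (hψ : IsSmoothChart E ψ) {q : M}
    (hq : q ∈ ψ.source) : VDiffAt E ψ q := hψ.mdifferentiable.mdifferentiableAt hq

/-- The differential of a smooth chart, as an isomorphism. -/
noncomputable def IsSmoothChart.equiv {ψ : OpenPartialHomeomorph M F} (hψ : IsSmoothChart E ψ)
    {q : M} (hq : q ∈ ψ.source) : TangentSpace 𝓘(ℝ, E) q ≃L[ℝ] F := hψ.mdifferentiable.mfderiv hq

lemma IsSmoothChart.coe_equiv {ψ : OpenPartialHomeomorph M F} (hψ : IsSmoothChart E ψ)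
    {q : M} (hq : q ∈ ψ.source) :
    (hψ.equiv hq : TangentSpace 𝓘(ℝ, E) q →L[ℝ] F) = vdif ψ q := rfl

lemma IsSmoothChart.injective {ψ : OpenPartialHomeomorph M F} (hψ : IsSmoothChart E ψ)
    {q : M} (hq : q ∈ ψ.source) : Function.Injective (vdif (E := E) ψ q) :=
  (hψ.equiv hq).injective

lemma IsSmoothChart.vdif_inverse {ψ : OpenPartialHomeomorph M F} (hψ : IsSmoothChart E ψ)
    {q : M} (hq : q ∈ ψ.source) (a : F) : vdif (E := E) ψ q ((vdif ψ q).inverse a) = a := by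
  rw [← hψ.coe_equiv hq, ContinuousLinearMap.inverse_equiv]
  exact (hψ.equiv hq).apply_symm_apply a

lemma IsSmoothChart.inverse_eq {ψ : OpenPartialHomeomorph M F} (hψ : IsSmoothChart E ψ)
    {q : M} (hq : q ∈ ψ.source) (a : F) :
    (vdif (E := E) ψ q).inverse a = mfderiv 𝓘(ℝ, F) 𝓘(ℝ, E) ψ.symm (ψ q) a := by
  rw [← hψ.coe_equiv hq, ContinuousLinearMap.inverse_equiv]
  rfl

/-- The differential of a function in a chart. -/
lemma IsSmoothChart.vdif_eq {ψ : OpenPartialHomeomorph M F} (hψ : IsSmoothChart E ψ)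
    {G : Type*} [NormedAddCommGroup G] [NormedSpace ℝ G] {f : M → G}
    {q : M} (hq : q ∈ ψ.source) (hf : VDiffAt E f q) (v : TangentSpace 𝓘(ℝ, E) q) :
    vdif f q v = fderiv ℝ (fun z ↦ f (ψ.symm z)) (ψ q) (vdif ψ q v) := by
  have h1 : DifferentiableAt ℝ (fun z ↦ f (ψ.symm z)) (ψ q) := by
    have : MDifferentiableAt 𝓘(ℝ, F) 𝓘(ℝ, G) (f ∘ ψ.symm) (ψ q) := by
      refine MDifferentiableAt.comp (I' := 𝓘(ℝ, E)) _ ?_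
        (hψ.mdifferentiable.mdifferentiableAt_symm (ψ.map_source hq))
      rwa [ψ.left_inv hq]
    exact this.differentiableAt
  rw [← vdif_comp h1 (hψ.vdiffAt hq)]
  refine DFunLike.congr_fun (vdif_congr ?_) v
  filter_upwards [ψ.open_source.mem_nhds hq] with x hx
  rw [ψ.left_inv hx]

lemma IsSmoothChart.restr {ψ : OpenPartialHomeomorph M F} (hψ : IsSmoothChart E ψ) {s : Set M} (hs : IsOpen s) :
    IsSmoothChart E (ψ.restrOpen s hs) :=
  ⟨hψ.1.mono inter_subset_left, hψ.2.mono fun _ hz ↦ hz.1⟩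

lemma IsSmoothChart.transHomeomorph {G : Type*} [NormedAddCommGroup G] [NormedSpace ℝ G]
    {ψ : OpenPartialHomeomorph M F} (hψ : IsSmoothChart E ψ) (e : F ≃ₜ G) (he : ContDiff ℝ ∞ e)
    (he' : ContDiff ℝ ∞ e.symm) : IsSmoothChart E (ψ.transHomeomorph e) :=
  ⟨he.contMDiff.comp_contMDiffOn hψ.1,
    hψ.2.comp he'.contMDiff.contMDiffOn fun _ hz ↦ hz⟩

lemma smoothFun_const (U : Set M) (r : ℝ) : SmoothFun (E := E) U (fun _ ↦ r) := contMDiffOn_const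

variable [IsManifold 𝓘(ℝ, E) ∞ M]

lemma isSmoothChart_chartAt (p : M) : IsSmoothChart E (chartAt E p) :=
  ⟨contMDiffOn_chart, contMDiffOn_chart_symm⟩

lemma VSmooth.vdif_apply {U : Set M} (hU : IsOpen U) {f : M → F} (hf : VSmooth E U f)
    {X : VecField E M} (hX : SmoothField U X) : VSmooth E U (fun q ↦ vdif f q (X q)) := by
  have : IsManifold 𝓘(ℝ, E) 1 M := IsManifold.of_le (n := ∞) (by simp)
  have h1 := ContMDiffOn.contMDiffOn_tangentMapWithin (m := ∞) hf (by simp) hU.uniqueMDiffOn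
  have h2 := h1.comp hX (fun q hq ↦ hq)
  have h3 := (contMDiff_snd_tangentBundle_modelSpace F 𝓘(ℝ, F) (n := ∞)).comp_contMDiffOn h2
  refine h3.congr fun q hq ↦ ?_
  change _ = mfderivWithin 𝓘(ℝ, E) 𝓘(ℝ, F) f U q (X q)
  rw [mfderivWithin_of_isOpen hU hq]
  rfl

lemma SmoothFun.dif {U : Set M} (hU : IsOpen U) {f : M → ℝ} (hf : SmoothFun (E := E) U f) :
    SmoothForm U (dif (E := E) f) := by
  have : IsManifold 𝓘(ℝ, E) 1 M := IsManifold.of_le (n := ∞) (by simp)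
  intro q hq
  refine ContMDiffAt.contMDiffWithinAt ?_
  have h1 := ContMDiffAt.mfderiv_const (m := ∞) (hf.contMDiffAt (hU.mem_nhds hq)) (by simp)
  refine (contMDiffAt_hom_bundle _).2 ⟨contMDiffAt_id, ?_⟩
  refine h1.congr_of_eventuallyEq (Eventually.of_forall fun x ↦ ?_)
  simp [inTangentCoordinates, ContinuousLinearMap.inCoordinates, PoissonPolarization.dif]
  exact (ContinuousLinearMap.id_comp _).symm

lemma SmoothForm.apply {U : Set M} {ξ : OneForm E M} (hξ : SmoothForm U ξ) {X : VecField E M}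
    (hX : SmoothField U X) : SmoothFun (E := E) U (fun q ↦ ξ q (X q)) := by
  have h1 := ContMDiffOn.clm_bundle_apply (E₂ := Bundle.Trivial M ℝ) hξ hX
  intro q hq
  exact (Bundle.contMDiffWithinAt_totalSpace.1 (h1 q hq)).2

/-- A vector field with smooth components is smooth. -/
lemma IsSmoothChart.smoothField {ψ : OpenPartialHomeomorph M F} (hψ : IsSmoothChart E ψ)
    {U : Set M} (hU : U ⊆ ψ.source) {V : M → F} (hV : VSmooth E U V) :
    SmoothField U (fun q ↦ (vdif (E := E) ψ q).inverse (V q)) := by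
  have : IsManifold 𝓘(ℝ, E) 1 M := IsManifold.of_le (n := ∞) (by simp)
  have h1 := ContMDiffOn.contMDiffOn_tangentMapWithin (m := ∞) hψ.2 (by simp)
    ψ.open_target.uniqueMDiffOn
  have h2 : ContMDiffOn 𝓘(ℝ, E) (𝓘(ℝ, F).prod 𝓘(ℝ, F)) ∞
      (fun q ↦ (⟨ψ q, V q⟩ : TangentBundle 𝓘(ℝ, F) F)) U := by
    intro q hq
    refine Bundle.contMDiffWithinAt_totalSpace.2 ⟨(hψ.1.mono hU) q hq, ?_⟩
    convert! hV q hq with y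
    simp
  have h3 := h1.comp h2 (fun q hq ↦ ψ.map_source (hU hq))
  refine h3.congr fun q hq ↦ ?_
  have h4 : ψ.symm (ψ q) = q := ψ.left_inv (hU hq)
  have h5 : mfderivWithin 𝓘(ℝ, F) 𝓘(ℝ, E) ψ.symm ψ.target (ψ q) (V q) =
      (vdif (E := E) ψ q).inverse (V q) := by
    rw [mfderivWithin_of_isOpen ψ.open_target (ψ.map_source (hU hq)), hψ.inverse_eq (hU hq)]
  exact Bundle.TotalSpace.ext h4.symm (heq_of_eq h5.symm)

/-- The Lie bracket in a chart. -/
lemma IsSmoothChart.vdif_mlieBracket [CompleteSpace E] [CompleteSpace F]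
    {ψ : OpenPartialHomeomorph M F}
    (hψ : IsSmoothChart E ψ) {U : Set M} (hU : IsOpen U) {X Y : VecField E M}
    (hX : SmoothField U X) (hY : SmoothField U Y) {q : M} (hq : q ∈ U) (hqψ : q ∈ ψ.source) :
    vdif ψ q (VectorField.mlieBracket 𝓘(ℝ, E) X Y q) =
      VectorField.lieBracket ℝ (fun z ↦ vdif ψ (ψ.symm z) (X (ψ.symm z)))
        (fun z ↦ vdif ψ (ψ.symm z) (Y (ψ.symm z))) (ψ q) := by
  have : IsManifold 𝓘(ℝ, E) 1 M := IsManifold.of_le (n := ∞) (by simp)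
  have : IsManifold 𝓘(ℝ, E) (minSmoothness ℝ 2) M :=
    IsManifold.of_le (n := ∞) (by simpa using two_le_infty)
  have hqt := ψ.map_source hqψ
  have hX' : MDifferentiableAt 𝓘(ℝ, E) (𝓘(ℝ, E).prod 𝓘(ℝ, E))
      (fun x ↦ (⟨x, X x⟩ : TangentBundle 𝓘(ℝ, E) M)) (ψ.symm (ψ q)) := by
    rw [ψ.left_inv hqψ]
    exact (hX.contMDiffAt (hU.mem_nhds hq)).mdifferentiableAt (by simp)
  have hY' : MDifferentiableAt 𝓘(ℝ, E) (𝓘(ℝ, E).prod 𝓘(ℝ, E))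
      (fun x ↦ (⟨x, Y x⟩ : TangentBundle 𝓘(ℝ, E) M)) (ψ.symm (ψ q)) := by
    rw [ψ.left_inv hqψ]
    exact (hY.contMDiffAt (hU.mem_nhds hq)).mdifferentiableAt (by simp)
  have h1 := VectorField.mpullback_mlieBracket (n := 2) hX' hY'
    ((hψ.2.contMDiffAt (ψ.open_target.mem_nhds hqt)).of_le two_le_infty) (by simp)
  have hpull : ∀ Z : VecField E M, ∀ z ∈ ψ.target,
      VectorField.mpullback 𝓘(ℝ, F) 𝓘(ℝ, E) ψ.symm Z z = vdif ψ (ψ.symm z) (Z (ψ.symm z)) := by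
    intro Z z hz
    rw [VectorField.mpullback_apply]
    have h2 : mfderiv 𝓘(ℝ, F) 𝓘(ℝ, E) ψ.symm z =
        ((hψ.equiv (ψ.map_target hz)).symm : F →L[ℝ] TangentSpace 𝓘(ℝ, E) (ψ.symm z)) := by
      ext a
      conv_lhs => rw [← ψ.right_inv hz]
      rfl
    rw [h2]
    erw [ContinuousLinearMap.inverse_equiv]
    rfl
  rw [hpull _ _ hqt] at h1
  have h3 : ∀ Z : VecField E M, VectorField.mpullback 𝓘(ℝ, F) 𝓘(ℝ, E) ψ.symm Z =ᶠ[𝓝 (ψ q)]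
      fun z ↦ vdif ψ (ψ.symm z) (Z (ψ.symm z)) := by
    intro Z
    filter_upwards [ψ.open_target.mem_nhds hqt] with z hz using hpull Z z hz
  rw [(h3 X).mlieBracket_vectorField_eq (h3 Y)] at h1
  have h4 : ∀ V W : (x : F) → TangentSpace 𝓘(ℝ, F) x,
      VectorField.mlieBracket 𝓘(ℝ, F) V W (ψ q) = VectorField.lieBracket ℝ V W (ψ q) := by
    intro V W
    rw [← VectorField.mlieBracketWithin_univ, VectorField.mlieBracketWithin_eq_lieBracketWithin]
    exact congrFun (VectorField.lieBracketWithin_univ (𝕜 := ℝ) (E := F) (V := V) (W := W)) _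
  have h5 := h1.trans (h4 _ _)
  rwa [ψ.left_inv hqψ] at h5

/-- In the preferred chart at `q`, the form `df` becomes the derivative of `f ∘ c⁻¹`, so `extD`
antisymmetrises a second derivative, which is symmetric. -/
lemma extD_dif {U : Set M} (hU : IsOpen U) {f : M → ℝ} (hf : SmoothFun (E := E) U f) {q : M}
    (hq : q ∈ U) : extD (dif (E := E) f) q = 0 := by
  have : IsManifold 𝓘(ℝ, E) 1 M := IsManifold.of_le (n := ∞) (by simp)
  set c := chartAt E q
  have hc : IsSmoothChart E c := ⟨contMDiffOn_chart, contMDiffOn_chart_symm⟩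
  have hcq : c q ∈ c.target := mem_chart_target E q
  have hcs : c.symm (c q) = q := c.left_inv (mem_chart_source E q)
  set g : E → ℝ := fun y ↦ f (c.symm y)
  have hS : IsOpen (c.target ∩ c.symm ⁻¹' U) := c.symm.isOpen_inter_preimage hU
  have hqS : c q ∈ c.target ∩ c.symm ⁻¹' U := ⟨hcq, by rwa [mem_preimage, hcs]⟩
  have hg : ContDiffOn ℝ ∞ g (c.target ∩ c.symm ⁻¹' U) := VSmooth.contDiffOn_symm hf hc
  have hA : (fun y ↦ (dif f (c.symm y)).comp (mfderiv 𝓘(ℝ, E) 𝓘(ℝ, E) c.symm y) :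
      E → (E →L[ℝ] ℝ)) =ᶠ[𝓝 (c q)] fderiv ℝ g := by
    filter_upwards [hS.mem_nhds hqS] with y hy
    have h1 := mfderiv_comp y (I' := 𝓘(ℝ, E)) (g := f) (f := c.symm)
      (VSmooth.vdiffAt (F := ℝ) hf hU hy.2)
      (hc.mdifferentiable.mdifferentiableAt_symm hy.1)
    rw [mfderiv_eq_fderiv] at h1
    exact h1.symm
  have hsymm : IsSymmSndFDerivAt ℝ g (c q) :=
    (hg.contDiffAt (hS.mem_nhds hqS)).isSymmSndFDerivAt (by simpa using two_le_infty)
  have h2 : ∀ u v, extD (dif (E := E) f) q u v =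
      fderiv ℝ (fderiv ℝ g) (c q) (mfderiv 𝓘(ℝ, E) 𝓘(ℝ, E) c q u)
        (mfderiv 𝓘(ℝ, E) 𝓘(ℝ, E) c q v) -
      fderiv ℝ (fderiv ℝ g) (c q) (mfderiv 𝓘(ℝ, E) 𝓘(ℝ, E) c q v)
        (mfderiv 𝓘(ℝ, E) 𝓘(ℝ, E) c q u) := by
    intro u v
    rw [← hA.fderiv_eq]
    rfl
  ext u v
  rw [h2]
  exact sub_eq_zero.2 (hsymm _ _)

end ManifoldToolkit

/-! ### Charts in which the foliation is a graph -/

section AdaptedChart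

variable {E : Type*} [NormedAddCommGroup E] [NormedSpace ℝ E]
  {M : Type*} [TopologicalSpace M] [ChartedSpace E M] [IsManifold 𝓘(ℝ, E) ∞ M]
  {k l : ℕ}

/-- In the smooth chart `ψ`, the tangent distribution of the foliation `P` is the graph of `A`. -/
structure IsGraphChart (P : Foliation E M)
    (ψ : OpenPartialHomeomorph M ((Fin k → ℝ) × (Fin l → ℝ)))
    (A : (Fin k → ℝ) × (Fin l → ℝ) → (Fin k → ℝ) →L[ℝ] (Fin l → ℝ)) : Prop where
  chart : IsSmoothChart E ψ
  smooth : ContDiffOn ℝ ∞ A ψ.target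
  mem_fiber : ∀ q ∈ ψ.source, ∀ v, v ∈ P.fiber q ↔ (vdif ψ q v).2 = A (ψ q) (vdif ψ q v).1

/-- Turns a frame of `P` at the base point into the first `k` coordinate axes; `l` is the dimension
of a chosen complement of its span. -/
lemma exists_linearEquiv_of_linearIndependent [FiniteDimensional ℝ E] {b : Fin k → E}
    (hb : LinearIndependent ℝ b) :
    ∃ (l : ℕ) (L : E ≃L[ℝ] (Fin k → ℝ) × (Fin l → ℝ)), ∀ i, L (b i) = (Pi.single i 1, 0) := by
  obtain ⟨T, hT⟩ := Submodule.exists_isCompl (Submodule.span ℝ (range b))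
  refine ⟨Module.finrank ℝ T, (((Submodule.prodEquivOfIsCompl _ T hT).symm.trans
    (LinearEquiv.prodCongr (Module.Basis.span hb).equivFun
      (Module.finBasis ℝ T).equivFun)).toContinuousLinearEquiv), fun i ↦ ?_⟩
  have h1 : b i = ((Module.Basis.span hb i : Submodule.span ℝ (range b)) : E) := by
    rw [Module.Basis.span_apply]
  simp only [LinearEquiv.coe_toContinuousLinearEquiv', LinearEquiv.trans_apply]
  rw [h1, Submodule.prodEquivOfIsCompl_symm_apply_left]
  ext j
  · simp [Finsupp.single_apply, Pi.single_apply, eq_comm]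
  · simp

/-- Every point has a chart in which the tangent distribution is a graph. -/
theorem exists_isGraphChart [FiniteDimensional ℝ E] (P : Foliation E M) (p : M) :
    ∃ (k l : ℕ) (ψ : OpenPartialHomeomorph M ((Fin k → ℝ) × (Fin l → ℝ)))
      (A : (Fin k → ℝ) × (Fin l → ℝ) → (Fin k → ℝ) →L[ℝ] (Fin l → ℝ)),
      IsGraphChart P ψ A ∧ p ∈ ψ.source ∧ ψ p = 0 := by
  obtain ⟨U, hU, hpU, k, e, he, hspan⟩ := P.exists_frame p
  set c := chartAt E p
  have hc : IsSmoothChart E c := isSmoothChart_chartAt p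
  have hpc : p ∈ c.source := mem_chart_source E p
  have hb : LinearIndependent ℝ fun i ↦ hc.equiv hpc (e i p) :=
    (hspan p hpU).1.map' (hc.equiv hpc).toLinearEquiv.toLinearMap (hc.equiv hpc).toLinearEquiv.ker
  obtain ⟨l, L, hL⟩ := exists_linearEquiv_of_linearIndependent hb
  set h : E ≃ₜ (Fin k → ℝ) × (Fin l → ℝ) :=
    L.toHomeomorph.trans (Homeomorph.addRight (-L (c p)))
  have hh : ∀ z, h z = L z + -L (c p) := fun z ↦ rfl
  have hψ₀ : IsSmoothChart E (c.transHomeomorph h) :=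
    hc.transHomeomorph h (L.contDiff.add contDiff_const)
      (L.symm.contDiff.comp (contDiff_id.add contDiff_const))
  set ψ₀ := c.transHomeomorph h
  have hpψ₀ : p ∈ ψ₀.source := hpc
  have hψ₀p : ψ₀ p = 0 := (hh _).trans (add_neg_cancel _)
  have hLd : ∀ q ∈ c.source, ∀ v : TangentSpace 𝓘(ℝ, E) q, vdif ψ₀ q v = L (vdif c q v) := by
    intro q hq v
    have h1 : HasFDerivAt h (L : E →L[ℝ] _) (c q) := L.hasFDerivAt.add_const _
    have h2 := vdif_comp h1.differentiableAt (hc.vdiffAt hq) v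
    rw [h1.fderiv] at h2
    exact h2
  set e' : Fin k → (Fin k → ℝ) × (Fin l → ℝ) → (Fin k → ℝ) × (Fin l → ℝ) := fun i z ↦
    vdif ψ₀ (ψ₀.symm z) (e i (ψ₀.symm z))
  set S₁ := ψ₀.target ∩ ψ₀.symm ⁻¹' (U ∩ ψ₀.source)
  have hS₁ : IsOpen S₁ := ψ₀.symm.isOpen_inter_preimage (hU.inter ψ₀.open_source)
  have he' : ∀ i, ContDiffOn ℝ ∞ (e' i) S₁ := fun i ↦
    (VSmooth.vdif_apply (hU.inter ψ₀.open_source) (hψ₀.1.mono inter_subset_right)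
      ((he i).mono inter_subset_left)).contDiffOn_symm hψ₀
  set F : (Fin k → ℝ) × (Fin l → ℝ) → (Fin k → ℝ) →L[ℝ] (Fin k → ℝ) × (Fin l → ℝ) := fun z ↦
    ∑ i, (ContinuousLinearMap.proj i : (Fin k → ℝ) →L[ℝ] ℝ).smulRight (e' i z)
  have hF : ContDiffOn ℝ ∞ F S₁ := ContDiffOn.sum fun i _ ↦
    (ContinuousLinearMap.smulRightL ℝ (Fin k → ℝ) ((Fin k → ℝ) × (Fin l → ℝ))
      (ContinuousLinearMap.proj i)).contDiff.comp_contDiffOn (he' i)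
  have hFa : ∀ z a, F z a = ∑ i, a i • e' i z := by
    intro z a
    simp [F]
  -- `F z` has the frame, read in the chart, as its columns, and `B` is its first block, the
  -- identity at the origin. Where `B` is invertible, the span of the frame is the graph of the
  -- second block composed with `B⁻¹`.
  set B : (Fin k → ℝ) × (Fin l → ℝ) → (Fin k → ℝ) →L[ℝ] (Fin k → ℝ) := fun z ↦
    ContinuousLinearMap.fst ℝ _ _ ∘L F z
  have hB : ContDiffOn ℝ ∞ B S₁ := contDiffOn_const.clm_comp hF
  have h0S₁ : (0 : (Fin k → ℝ) × (Fin l → ℝ)) ∈ S₁ := by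
    rw [← hψ₀p]
    refine ⟨ψ₀.map_source hpψ₀, ?_⟩
    rw [mem_preimage, ψ₀.left_inv hpψ₀]
    exact ⟨hpU, hpψ₀⟩
  have hB0 : B 0 = ContinuousLinearEquiv.refl ℝ (Fin k → ℝ) := by
    ext a j
    change (F 0 a).1 j = a j
    have h1 : ∀ i, e' i 0 = (Pi.single i 1, 0) := by
      intro i
      change vdif ψ₀ (ψ₀.symm 0) (e i (ψ₀.symm 0)) = _
      rw [← hψ₀p, ψ₀.left_inv hpψ₀, hLd p hpc]
      exact hL i
    rw [hFa]
    simp [h1, Prod.fst_sum, Finset.sum_apply, Pi.single_apply]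
  set S : Set ((Fin k → ℝ) × (Fin l → ℝ)) := S₁ ∩ B ⁻¹'
    range ((↑) : ((Fin k → ℝ) ≃L[ℝ] (Fin k → ℝ)) → (Fin k → ℝ) →L[ℝ] (Fin k → ℝ))
  have hS : IsOpen S := hB.continuousOn.isOpen_inter_preimage hS₁ ContinuousLinearEquiv.isOpen
  have hψ₀S : IsOpen (ψ₀.source ∩ ψ₀ ⁻¹' S) := ψ₀.isOpen_inter_preimage hS
  have hmem : ∀ q ∈ (ψ₀.restrOpen _ hψ₀S).source, q ∈ ψ₀.source ∧ ψ₀ q ∈ S := fun q hq ↦ hq.2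
  refine ⟨k, l, ψ₀.restrOpen _ hψ₀S,
    fun z ↦ ContinuousLinearMap.snd ℝ _ _ ∘L F z ∘L (B z).inverse, ⟨hψ₀.restr _, ?_, ?_⟩, ?_, hψ₀p⟩
  · intro z hz
    have hzS : z ∈ S := by
      have := hz.2.2
      rwa [mem_preimage, ψ₀.right_inv hz.1] at this
    have h1 : ContDiffAt ℝ ∞ F z := hF.contDiffAt (hS₁.mem_nhds hzS.1)
    have h2 : ContDiffAt ℝ ∞ (fun z ↦ (B z).inverse) z := by
      obtain ⟨b, hb⟩ := hzS.2
      refine ContDiffAt.comp (g := ContinuousLinearMap.inverse) z ?_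
        (hB.contDiffAt (hS₁.mem_nhds hzS.1))
      rw [← hb]
      exact contDiffAt_map_inverse b
    exact (contDiffAt_const.clm_comp (h1.clm_comp h2)).contDiffWithinAt
  · intro q hq v
    obtain ⟨hq1, hqS⟩ := hmem q hq
    change v ∈ P.fiber q ↔ (vdif ψ₀ q v).2 = (F (ψ₀ q) ((B (ψ₀ q)).inverse (vdif ψ₀ q v).1)).2
    have hqU : q ∈ U := by
      have := hqS.1.2.1
      rwa [ψ₀.left_inv hq1] at this
    obtain ⟨b, hb⟩ := hqS.2
    rw [← hb, ContinuousLinearMap.inverse_equiv]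
    have hBF : ∀ a, (F (ψ₀ q) a).1 = b a := fun a ↦ (DFunLike.congr_fun hb a).symm
    have hF2 : ∀ a, F (ψ₀ q) a = vdif ψ₀ q (∑ i, a i • e i q) := by
      intro a
      rw [hFa, map_sum]
      refine Finset.sum_congr rfl fun i _ ↦ ?_
      rw [map_smul]
      exact congrArg (fun q' ↦ a i • vdif ψ₀ q' (e i q')) (ψ₀.left_inv hq1)
    rw [← (hspan q hqU).2, Submodule.mem_span_range_iff_exists_fun]
    constructor
    · rintro ⟨a, rfl⟩
      rw [← hF2, hBF]
      simp
    · intro hv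
      refine ⟨b.symm (vdif ψ₀ q v).1, hψ₀.injective hq1 ?_⟩
      rw [← hF2]
      refine Prod.ext ?_ hv.symm
      rw [hBF]
      exact b.apply_symm_apply _
  · refine ⟨hpψ₀, hpψ₀, ?_⟩
    rw [mem_preimage, hψ₀p]
    exact ⟨h0S₁, _, hB0.symm⟩

end AdaptedChart

/-! ### Locality of the partial connection -/

section Connection

variable {E : Type*} [NormedAddCommGroup E] [NormedSpace ℝ E]
  {M : Type*} [TopologicalSpace M] [ChartedSpace E M] [IsManifold 𝓘(ℝ, E) ∞ M]
  {P : Foliation E M} (D : PartialConnection P)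

lemma smoothField_of_eq_zero {U : Set M} {X : VecField E M} (hX : ∀ x ∈ U, X x = 0) :
    SmoothField U X := by
  have : IsManifold 𝓘(ℝ, E) 1 M := IsManifold.of_le (n := ∞) (by simp)
  refine ContMDiffOn.congr (f := fun x ↦ Bundle.TotalSpace.mk' E
    (E := fun x : M ↦ TangentSpace 𝓘(ℝ, E) x) x 0) ?_ fun x hx ↦ by rw [hX x hx]
  exact (Bundle.contMDiff_zeroSection ℝ (fun x : M ↦ TangentSpace 𝓘(ℝ, E) x)).contMDiffOn

/-- Sections are defined on all of `M`, so locality has to come from the Leibniz rule. The function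
`f`, equal to `0` on `U` and `1` elsewhere, satisfies `f • Z = Z` and is smooth on `U`; both terms
of the rule vanish there. -/
lemma PartialConnection.cov_eq_zero_of_eq_zero {U : Set M} (hU : IsOpen U) {Z : P.Sec}
    (hZ : ∀ x ∈ U, Z x = 0) {x : M} (hx : x ∈ U) : D.cov Z x = 0 := by
  classical
  ext v
  set f : M → ℝ := fun y ↦ if y ∈ U then 0 else 1
  have hfZ : (fun y ↦ f y • Z y) = Z := by
    funext y
    by_cases hy : y ∈ U
    · simp [f, hy, hZ y hy]
    · simp [f, hy]
  have hf : SmoothFun (E := E) U f := (smoothFun_const U 0).congr fun y hy ↦ by simp [f, hy]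
  have h1 := D.leibniz U hU f Z hf
    (smoothField_of_eq_zero fun y hy ↦ by simp [Foliation.Sec.field, hZ y hy]) x hx v
  rw [hfZ, hZ x hx, smul_zero, add_zero] at h1
  have h2 : f x = 0 := by simp [f, hx]
  rw [h1, h2, zero_smul]
  rfl

/-- The covariant derivative is local. -/
lemma PartialConnection.cov_congr {U : Set M} (hU : IsOpen U) {Y Z : P.Sec}
    (hY : SmoothField U Y.field) (h : ∀ x ∈ U, Z x = Y x) {x : M} (hx : x ∈ U) :
    D.cov Z x = D.cov Y x := by
  have hW : ∀ x ∈ U, Z x - Y x = 0 := fun x hx ↦ sub_eq_zero.2 (h x hx)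
  have h1 := D.add U hU Y (fun y ↦ Z y - Y y) hY
    (smoothField_of_eq_zero fun y hy ↦ by
      change ((Z y - Y y : P.fiber y) : TangentSpace 𝓘(ℝ, E) y) = 0
      rw [hW y hy]; rfl) x hx
  rw [D.cov_eq_zero_of_eq_zero hU hW hx, add_zero] at h1
  rw [← h1]
  congr 1
  funext y
  abel

lemma smoothField_smul {U : Set M} {f : M → ℝ} {X : VecField E M} (hf : SmoothFun (E := E) U f)
    (hX : SmoothField U X) : SmoothField U (fun x ↦ f x • X x) :=
  ContMDiffOn.smul_section hf hX

lemma smoothField_sum {ι : Type*} {U : Set M} {X : ι → VecField E M} (s : Finset ι)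
    (hX : ∀ i ∈ s, SmoothField U (X i)) : SmoothField U (fun x ↦ ∑ i ∈ s, X i x) :=
  ContMDiffOn.sum_section hX

lemma PartialConnection.cov_sum {U : Set M} (hU : IsOpen U) {ι : Type*} (s : Finset ι)
    {f : ι → M → ℝ} {Y : ι → P.Sec} (hf : ∀ i ∈ s, SmoothFun (E := E) U (f i))
    (hY : ∀ i ∈ s, SmoothField U (Y i).field) {x : M} (hx : x ∈ U) (v : P.fiber x) :
    D.cov (fun y ↦ ∑ i ∈ s, f i y • Y i y) x v = ∑ i ∈ s, (f i x • D.cov (Y i) x v +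
      (dif (f i) x (v : TangentSpace 𝓘(ℝ, E) x)) • Y i x) := by
  classical
  induction s using Finset.induction_on with
  | empty =>
    simp only [Finset.sum_empty]
    rw [D.cov_eq_zero_of_eq_zero hU (fun _ _ ↦ rfl) hx]
    rfl
  | insert i s hi ih =>
    simp only [Finset.sum_insert hi]
    have h1 : SmoothField U (Foliation.Sec.field (fun y ↦ f i y • Y i y : P.Sec)) :=
      smoothField_smul (hf i (Finset.mem_insert_self i s)) (hY i (Finset.mem_insert_self i s))
    have h2 : SmoothField U (Foliation.Sec.field (fun y ↦ ∑ i ∈ s, f i y • Y i y : P.Sec)) := by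
      refine (smoothField_sum s fun i hi ↦ smoothField_smul (hf i (Finset.mem_insert_of_mem hi))
        (hY i (Finset.mem_insert_of_mem hi))).congr fun y hy ↦ ?_
      simp [Foliation.Sec.field]
    rw [D.add U hU _ _ h1 h2 x hx, LinearMap.add_apply,
      D.leibniz U hU _ _ (hf i (Finset.mem_insert_self i s)) (hY i (Finset.mem_insert_self i s))
        x hx, ih (fun i hi ↦ hf i (Finset.mem_insert_of_mem hi))
        (fun i hi ↦ hY i (Finset.mem_insert_of_mem hi))]

end Connection

/-! ### Christoffel symbols in a graph chart -/

lemma contDiffOn_smulRight {Z V W : Type*} [NormedAddCommGroup Z] [NormedSpace ℝ Z]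
    [NormedAddCommGroup V] [NormedSpace ℝ V] [NormedAddCommGroup W] [NormedSpace ℝ W]
    (c : V →L[ℝ] ℝ) {f : Z → W} {s : Set Z} (hf : ContDiffOn ℝ ∞ f s) :
    ContDiffOn ℝ ∞ (fun z ↦ c.smulRight (f z)) s :=
  (ContinuousLinearMap.smulRightL ℝ V W c).contDiff.comp_contDiffOn hf

section Christoffel

variable {E : Type*} [NormedAddCommGroup E] [NormedSpace ℝ E]
  {M : Type*} [TopologicalSpace M] [ChartedSpace E M] [IsManifold 𝓘(ℝ, E) ∞ M]
  {k l : ℕ} {P : Foliation E M}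
  {ψ : OpenPartialHomeomorph M ((Fin k → ℝ) × (Fin l → ℝ))}
  {A : (Fin k → ℝ) × (Fin l → ℝ) → (Fin k → ℝ) →L[ℝ] (Fin l → ℝ)}

namespace IsGraphChart

open Classical in
/-- The section of the tangent distribution whose first component in the chart is `V`. -/
noncomputable def sec (h : IsGraphChart P ψ A) (V : M → Fin k → ℝ) : P.Sec := fun q ↦
  if hq : q ∈ ψ.source then ⟨(vdif ψ q).inverse (V q, A (ψ q) (V q)), by
    rw [h.mem_fiber q hq, h.chart.vdif_inverse hq]⟩ else 0

lemma vdif_sec (h : IsGraphChart P ψ A) (V : M → Fin k → ℝ) {q : M} (hq : q ∈ ψ.source) :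
    vdif ψ q (h.sec V q : TangentSpace 𝓘(ℝ, E) q) = (V q, A (ψ q) (V q)) := by
  rw [sec, dif_pos hq]
  exact h.chart.vdif_inverse hq _

lemma smoothField_sec (h : IsGraphChart P ψ A) {V : M → Fin k → ℝ} {U : Set M}
    (hU : U ⊆ ψ.source) (hV : VSmooth E U V) : SmoothField U (h.sec V).field := by
  have h1 : VSmooth E U (fun q ↦ A (ψ q)) :=
    VSmooth.comp h.smooth (h.chart.1.mono hU) fun q hq ↦ ψ.map_source (hU hq)
  have h2 : VSmooth E U (fun q ↦ (V q, A (ψ q) (V q))) := hV.prodMk_space (h1.clm_apply hV)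
  refine (h.chart.smoothField hU h2).congr fun q hq ↦ ?_
  simp [Foliation.Sec.field, sec, hU hq]

lemma smoothField_sec_const (h : IsGraphChart P ψ A) (a : Fin k → ℝ) :
    SmoothField ψ.source (h.sec fun _ ↦ a).field :=
  h.smoothField_sec Subset.rfl contMDiffOn_const

lemma ext_fst (h : IsGraphChart P ψ A) {q : M} (hq : q ∈ ψ.source) {v w : P.fiber q}
    (hvw : (vdif ψ q (v : TangentSpace 𝓘(ℝ, E) q)).1 = (vdif ψ q (w : TangentSpace 𝓘(ℝ, E) q)).1) :
    v = w := by
  refine Subtype.ext (h.chart.injective hq (Prod.ext hvw ?_))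
  rw [(h.mem_fiber q hq _).1 v.2, (h.mem_fiber q hq _).1 w.2, hvw]

/-- The first component of a section. -/
noncomputable def fstComp (_ : IsGraphChart P ψ A) (Y : P.Sec) (q : M) : Fin k → ℝ :=
  (vdif ψ q (Y.field q)).1

lemma fstComp_sec (h : IsGraphChart P ψ A) (V : M → Fin k → ℝ) {q : M} (hq : q ∈ ψ.source) :
    h.fstComp (h.sec V) q = V q := congrArg Prod.fst (h.vdif_sec V hq)

lemma vsmooth_fstComp (h : IsGraphChart P ψ A) {Y : P.Sec} {U : Set M} (hU : IsOpen U)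
    (hUψ : U ⊆ ψ.source) (hY : SmoothField U Y.field) : VSmooth E U (h.fstComp Y) :=
  VSmooth.comp (h := Prod.fst) (s := univ) contDiff_fst.contDiffOn
    (VSmooth.vdif_apply hU (h.chart.1.mono hUψ) hY) (mapsTo_univ _ _)

/-- The Christoffel symbols of a partial connection. -/
noncomputable def christoffel (h : IsGraphChart P ψ A) (D : PartialConnection P)
    (z : (Fin k → ℝ) × (Fin l → ℝ)) : (Fin k → ℝ) →L[ℝ] (Fin k → ℝ) →L[ℝ] (Fin k → ℝ) :=
  ∑ i, (ContinuousLinearMap.proj i : (Fin k → ℝ) →L[ℝ] ℝ).smulRight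
    (∑ j, (ContinuousLinearMap.proj j : (Fin k → ℝ) →L[ℝ] ℝ).smulRight
      (h.fstComp (D.along (h.sec fun _ ↦ Pi.single i 1) (h.sec fun _ ↦ Pi.single j 1))
        (ψ.symm z)))

lemma contDiffOn_christoffel (h : IsGraphChart P ψ A) (D : PartialConnection P) :
    ContDiffOn ℝ ∞ (h.christoffel D) ψ.target := by
  have h1 : ∀ i j, ContDiffOn ℝ ∞ (fun z ↦ h.fstComp
      (D.along (h.sec fun _ ↦ Pi.single i 1) (h.sec fun _ ↦ Pi.single j 1)) (ψ.symm z))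
      ψ.target := by
    intro i j
    refine ((h.vsmooth_fstComp ψ.open_source Subset.rfl (D.smooth _ ψ.open_source _ _
      (h.smoothField_sec_const _) (h.smoothField_sec_const _))).contDiffOn_symm h.chart).mono ?_
    exact fun z hz ↦ ⟨hz, ψ.map_target hz⟩
  refine ContDiffOn.sum fun i _ ↦ ?_
  exact contDiffOn_smulRight _ (ContDiffOn.sum fun j _ ↦ contDiffOn_smulRight _ (h1 i j))

lemma christoffel_apply (h : IsGraphChart P ψ A) (D : PartialConnection P) {q : M}
    (hq : q ∈ ψ.source) (a b : Fin k → ℝ) :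
    h.christoffel D (ψ q) a b = ∑ i, ∑ j, a i • b j •
      h.fstComp (D.along (h.sec fun _ ↦ Pi.single i 1) (h.sec fun _ ↦ Pi.single j 1)) q := by
  simp [christoffel, ψ.left_inv hq, Finset.smul_sum]

lemma eq_sum_sec (h : IsGraphChart P ψ A) {q : M} (hq : q ∈ ψ.source) (v : P.fiber q) :
    v = ∑ i, (vdif ψ q (v : TangentSpace 𝓘(ℝ, E) q)).1 i • h.sec (fun _ ↦ Pi.single i 1) q := by
  refine h.ext_fst hq ?_
  ext m
  simp only [Submodule.coe_sum, Submodule.coe_smul, map_sum, map_smul, h.vdif_sec _ hq,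
    Prod.fst_sum, Prod.smul_fst, Finset.sum_apply, Pi.smul_apply, Pi.single_apply, smul_eq_mul,
    mul_ite, mul_one, mul_zero, Finset.sum_ite_eq, Finset.mem_univ, if_true]

/-- The covariant derivative in terms of Christoffel symbols. -/
theorem fst_vdif_cov (h : IsGraphChart P ψ A) (D : PartialConnection P) {U : Set M}
    (hU : IsOpen U) (hUψ : U ⊆ ψ.source) {Y : P.Sec} (hY : SmoothField U Y.field) {q : M}
    (hq : q ∈ U) (v : P.fiber q) :
    (vdif ψ q (D.cov Y q v : TangentSpace 𝓘(ℝ, E) q)).1 =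
      vdif (h.fstComp Y) q (v : TangentSpace 𝓘(ℝ, E) q) +
        h.christoffel D (ψ q) (vdif ψ q (v : TangentSpace 𝓘(ℝ, E) q)).1 (h.fstComp Y q) := by
  have hqψ := hUψ hq
  set ê : Fin k → P.Sec := fun j ↦ h.sec fun _ ↦ Pi.single j 1
  have hY1 := h.vsmooth_fstComp hU hUψ hY
  have hf : ∀ j, SmoothFun (E := E) U (fun q ↦ h.fstComp Y q j) := fun j ↦
    VSmooth.comp (h := fun a : Fin k → ℝ ↦ a j) (s := univ) (contDiff_apply ℝ ℝ j).contDiffOn hY1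
      (mapsTo_univ _ _)
  have hdf : ∀ j, dif (fun q ↦ h.fstComp Y q j) q (v : TangentSpace 𝓘(ℝ, E) q) =
      vdif (h.fstComp Y) q (v : TangentSpace 𝓘(ℝ, E) q) j := by
    intro j
    have h1 : HasFDerivAt (fun a : Fin k → ℝ ↦ a j) (ContinuousLinearMap.proj j)
      (h.fstComp Y q) := (ContinuousLinearMap.proj j : (Fin k → ℝ) →L[ℝ] ℝ).hasFDerivAt
    have h2 := vdif_comp h1.differentiableAt (hY1.vdiffAt hU hq) (v : TangentSpace 𝓘(ℝ, E) q)
    rw [h1.fderiv] at h2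
    exact h2
  have hYsum : ∀ x ∈ U, Y x = ∑ j, h.fstComp Y x j • ê j x := fun x hx ↦
    h.eq_sum_sec (hUψ hx) (Y x)
  have hsum : SmoothField U (Foliation.Sec.field (fun x ↦ ∑ j, h.fstComp Y x j • ê j x : P.Sec)) :=
    hY.congr fun x hx ↦ by simp only [Foliation.Sec.field, hYsum x hx]
  rw [D.cov_congr hU hsum hYsum hq, D.cov_sum hU _ (fun j _ ↦ hf j)
    (fun j _ ↦ (h.smoothField_sec_const _).mono hUψ) hq, h.christoffel_apply D hqψ,
    Finset.sum_add_distrib, add_comm]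
  simp only [Submodule.coe_add, map_add, Prod.fst_add]
  congr 1
  · simp only [hdf]
    ext m
    simp only [Submodule.coe_sum, Submodule.coe_smul, map_sum, map_smul, h.vdif_sec _ hqψ,
      Prod.fst_sum, Prod.smul_fst, Finset.sum_apply, Pi.smul_apply, Pi.single_apply, smul_eq_mul,
      mul_ite, mul_one, mul_zero, Finset.sum_ite_eq, Finset.mem_univ, if_true]
  · have hv : ∀ j, D.cov (ê j) q v = ∑ i, (vdif ψ q (v : TangentSpace 𝓘(ℝ, E) q)).1 i •
        D.along (ê i) (ê j) q := by
      intro j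
      conv_lhs => rw [h.eq_sum_sec hqψ v]
      simp only [map_sum, map_smul]
      rfl
    have hv' : ∀ j, (vdif ψ q (D.cov (ê j) q v : TangentSpace 𝓘(ℝ, E) q)).1 =
        ∑ i, (vdif ψ q (v : TangentSpace 𝓘(ℝ, E) q)).1 i •
          h.fstComp (D.along (ê i) (ê j)) q := by
      intro j
      rw [hv]
      simp only [Submodule.coe_sum, Submodule.coe_smul, map_sum, map_smul, Prod.fst_sum,
        Prod.smul_fst]
      rfl
    rw [Finset.sum_comm]
    simp only [Submodule.coe_sum, Submodule.coe_smul, map_sum, map_smul, Prod.fst_sum,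
      Prod.smul_fst]
    refine Finset.sum_congr rfl fun j _ ↦ ?_
    rw [hv' j, Finset.smul_sum]
    exact Finset.sum_congr rfl fun i _ ↦ smul_comm _ _ _

lemma fstComp_along (h : IsGraphChart P ψ A) (D : PartialConnection P) {Y : P.Sec}
    (hY : SmoothField ψ.source Y.field) (a : Fin k → ℝ) {q : M} (hq : q ∈ ψ.source) :
    h.fstComp (D.along (h.sec fun _ ↦ a) Y) q =
      fderiv ℝ (fun z ↦ h.fstComp Y (ψ.symm z)) (ψ q) (a, A (ψ q) a) +
        h.christoffel D (ψ q) a (h.fstComp Y q) := by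
  have h1 := h.fst_vdif_cov D ψ.open_source Subset.rfl hY hq (h.sec (fun _ ↦ a) q)
  rw [h.chart.vdif_eq hq ((h.vsmooth_fstComp ψ.open_source Subset.rfl hY).vdiffAt
    ψ.open_source hq), h.vdif_sec _ hq] at h1
  exact h1

lemma fstComp_along_sec_const (h : IsGraphChart P ψ A) (D : PartialConnection P)
    (a b : Fin k → ℝ) {q : M} (hq : q ∈ ψ.source) :
    h.fstComp (D.along (h.sec fun _ ↦ a) (h.sec fun _ ↦ b)) q = h.christoffel D (ψ q) a b := by
  rw [h.fstComp_along D (h.smoothField_sec_const b) a hq, h.fstComp_sec _ hq]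
  have h1 : (fun z ↦ h.fstComp (h.sec fun _ ↦ b) (ψ.symm z)) =ᶠ[𝓝 (ψ q)] fun _ ↦ b := by
    filter_upwards [ψ.open_target.mem_nhds (ψ.map_source hq)] with z hz
    exact h.fstComp_sec _ (ψ.map_target hz)
  rw [h1.fderiv_eq]
  simp

lemma vdif_mlieBracket_sec_const [CompleteSpace E] (h : IsGraphChart P ψ A) (a b : Fin k → ℝ)
    {q : M} (hq : q ∈ ψ.source) :
    vdif ψ q (VectorField.mlieBracket 𝓘(ℝ, E) (h.sec fun _ ↦ a).field (h.sec fun _ ↦ b).field q) =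
      (0, fderiv ℝ A (ψ q) (a, A (ψ q) a) b - fderiv ℝ A (ψ q) (b, A (ψ q) b) a) := by
  rw [h.chart.vdif_mlieBracket ψ.open_source (h.smoothField_sec_const a)
    (h.smoothField_sec_const b) hq hq]
  have hA : HasFDerivAt A (fderiv ℝ A (ψ q)) (ψ q) :=
    ((h.smooth.contDiffAt (ψ.open_target.mem_nhds (ψ.map_source hq))).differentiableAt
      (by simp)).hasFDerivAt
  have h1 : ∀ c : Fin k → ℝ, (fun z ↦ vdif ψ (ψ.symm z) ((h.sec fun _ ↦ c).field (ψ.symm z)))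
      =ᶠ[𝓝 (ψ q)] fun z ↦ (c, A z c) := by
    intro c
    filter_upwards [ψ.open_target.mem_nhds (ψ.map_source hq)] with z hz
    exact (h.vdif_sec _ (ψ.map_target hz)).trans (by rw [ψ.right_inv hz])
  have h2 : ∀ c : Fin k → ℝ, ∀ d, fderiv ℝ (fun z ↦ (c, A z c)) (ψ q) d =
      (0, fderiv ℝ A (ψ q) d c) := by
    intro c d
    have h3 := (hasFDerivAt_const c (ψ q)).prodMk (hA.clm_apply (hasFDerivAt_const c (ψ q)))
    rw [h3.fderiv]
    simp
  rw [(h1 a).lieBracket_vectorField_eq (h1 b), VectorField.lieBracket_eq]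
  beta_reduce
  rw [h2, h2]
  exact Prod.ext (sub_zero _) rfl

/-- The bracket of two sections with constant first components has first component `0`. By
involutivity it lies in the graph, so its second component, the difference of the two sides,
vanishes too. -/
lemma integrable [CompleteSpace E] (h : IsGraphChart P ψ A) {z : (Fin k → ℝ) × (Fin l → ℝ)}
    (hz : z ∈ ψ.target) (a b : Fin k → ℝ) :
    fderiv ℝ A z (a, A z a) b = fderiv ℝ A z (b, A z b) a := by
  have hq := ψ.map_target hz
  have h1 := P.involutive ψ.source ψ.open_source _ _ (h.smoothField_sec_const a)
    (h.smoothField_sec_const b) (fun x _ ↦ (h.sec (fun _ ↦ a) x).2)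
    (fun x _ ↦ (h.sec (fun _ ↦ b) x).2) (ψ.symm z) hq
  rw [h.mem_fiber _ hq, h.vdif_mlieBracket_sec_const a b hq, ψ.right_inv hz, map_zero] at h1
  exact sub_eq_zero.1 h1

lemma mlieBracket_sec_const [CompleteSpace E] (h : IsGraphChart P ψ A) (a b : Fin k → ℝ)
    {q : M} (hq : q ∈ ψ.source) :
    VectorField.mlieBracket 𝓘(ℝ, E) (h.sec fun _ ↦ a).field (h.sec fun _ ↦ b).field q = 0 := by
  refine h.chart.injective hq ?_
  rw [h.vdif_mlieBracket_sec_const a b hq, h.integrable (ψ.map_source hq), sub_self, map_zero]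
  rfl

/-- Sections with constant first components commute, so the torsion is the antisymmetric part of the
symbols. -/
lemma christoffel_symm [CompleteSpace E] (h : IsGraphChart P ψ A) {D : PartialConnection P}
    (hD : D.TorsionFree) {z : (Fin k → ℝ) × (Fin l → ℝ)} (hz : z ∈ ψ.target) (a b : Fin k → ℝ) :
    h.christoffel D z a b = h.christoffel D z b a := by
  have hq := ψ.map_target hz
  have h1 := hD ψ.source ψ.open_source _ _ (h.smoothField_sec_const a)
    (h.smoothField_sec_const b) (ψ.symm z) hq
  rw [h.mlieBracket_sec_const a b hq, sub_eq_zero] at h1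
  rw [← ψ.right_inv hz, ← h.fstComp_along_sec_const D a b hq,
    ← h.fstComp_along_sec_const D b a hq, fstComp, fstComp, h1]

/-- Evaluates the curvature on commuting sections, so that the section representing the bracket can
be taken to be `0`; the two sides are the components of `∇_a ∇_b c` and `∇_b ∇_a c`. -/
lemma christoffel_flat [CompleteSpace E] (h : IsGraphChart P ψ A) {D : PartialConnection P}
    (hD : D.Flat) {z : (Fin k → ℝ) × (Fin l → ℝ)} (hz : z ∈ ψ.target) (a b c : Fin k → ℝ) :
    fderiv ℝ (h.christoffel D) z (a, A z a) b c +
        h.christoffel D z a (h.christoffel D z b c) =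
      fderiv ℝ (h.christoffel D) z (b, A z b) a c +
        h.christoffel D z b (h.christoffel D z a c) := by
  have hq := ψ.map_target hz
  have h1 := hD ψ.source ψ.open_source _ _ _ (0 : P.Sec) (h.smoothField_sec_const a)
    (h.smoothField_sec_const b) (h.smoothField_sec_const c)
    (fun x hx ↦ (h.mlieBracket_sec_const a b hx).symm) (ψ.symm z) hq
  have h2 : ∀ Z : P.Sec, D.along (0 : P.Sec) Z (ψ.symm z) = 0 := fun Z ↦ map_zero _
  rw [h2, sub_zero, sub_eq_zero] at h1
  have hΓ : HasFDerivAt (h.christoffel D) (fderiv ℝ (h.christoffel D) z) z :=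
    (((h.contDiffOn_christoffel D).contDiffAt (ψ.open_target.mem_nhds hz)).differentiableAt
      (by simp)).hasFDerivAt
  have h3 : ∀ a b, h.fstComp (D.along (h.sec fun _ ↦ a) (D.along (h.sec fun _ ↦ b)
      (h.sec fun _ ↦ c))) (ψ.symm z) = fderiv ℝ (h.christoffel D) z (a, A z a) b c +
        h.christoffel D z a (h.christoffel D z b c) := by
    intro a b
    have hs : SmoothField ψ.source (D.along (h.sec fun _ ↦ b) (h.sec fun _ ↦ c)).field :=
      D.smooth _ ψ.open_source _ _ (h.smoothField_sec_const b) (h.smoothField_sec_const c)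
    rw [h.fstComp_along D hs a hq, h.fstComp_along_sec_const D b c hq, ψ.right_inv hz]
    congr 1
    have h4 : (fun z ↦ h.fstComp (D.along (h.sec fun _ ↦ b) (h.sec fun _ ↦ c)) (ψ.symm z))
        =ᶠ[𝓝 z] fun z ↦ h.christoffel D z b c := by
      filter_upwards [ψ.open_target.mem_nhds hz] with y hy
      rw [h.fstComp_along_sec_const D b c (ψ.map_target hy), ψ.right_inv hy]
    have h5 := (hΓ.clm_apply (hasFDerivAt_const b z)).clm_apply (hasFDerivAt_const c z)
    rw [h4.fderiv_eq, h5.fderiv]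
    simp
  rw [← h3 a b, ← h3 b a, fstComp, fstComp]
  simp only [Foliation.Sec.field, h1]

end IsGraphChart

end Christoffel

/-! ### Existence of affine charts -/

section AffineChart

variable {E : Type*} [NormedAddCommGroup E] [NormedSpace ℝ E]
  {M : Type*} [TopologicalSpace M] [ChartedSpace E M]

lemma IsSmoothChart.trans {F G : Type*} [NormedAddCommGroup F] [NormedSpace ℝ F]
    [NormedAddCommGroup G] [NormedSpace ℝ G] {ψ : OpenPartialHomeomorph M F}
    (hψ : IsSmoothChart E ψ) {α : OpenPartialHomeomorph F G} (hα : ContDiffOn ℝ ∞ α α.source)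
    (hα' : ContDiffOn ℝ ∞ α.symm α.target) : IsSmoothChart E (ψ.trans α) :=
  ⟨hα.contMDiffOn.comp (hψ.1.mono inter_subset_left) fun _ hq ↦ hq.2,
    hψ.2.comp (hα'.contMDiffOn.mono inter_subset_left) fun _ hz ↦ hz.2⟩

variable [IsManifold 𝓘(ℝ, E) ∞ M] {k l : ℕ}

/-- In the smooth chart `φ`, with convex image, the leaves of `P` are the subspaces of fixed second
component, and the partial connection `D` is the differential of first components. -/
structure IsAffineChart (P : Foliation E M) (D : PartialConnection P)
    (φ : OpenPartialHomeomorph M ((Fin k → ℝ) × (Fin l → ℝ))) : Prop where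
  chart : IsSmoothChart E φ
  convex : Convex ℝ φ.target
  mem_fiber : ∀ q ∈ φ.source, ∀ v, v ∈ P.fiber q ↔ (vdif φ q v).2 = 0
  fst_vdif_cov : ∀ U : Set M, IsOpen U → U ⊆ φ.source → ∀ Y : P.Sec, SmoothField U Y.field →
    ∀ q ∈ U, ∀ v : P.fiber q, (vdif φ q (D.cov Y q v : TangentSpace 𝓘(ℝ, E) q)).1 =
      vdif (fun q' ↦ (vdif φ q' (Y.field q')).1) q (v : TangentSpace 𝓘(ℝ, E) q)

theorem exists_isAffineChart [FiniteDimensional ℝ E] (P : Foliation E M) {D : PartialConnection P}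
    (htor : D.TorsionFree) (hflat : D.Flat) (p : M) :
    ∃ (k l : ℕ) (φ : OpenPartialHomeomorph M ((Fin k → ℝ) × (Fin l → ℝ))),
      IsAffineChart P D φ ∧ p ∈ φ.source := by
  have : CompleteSpace E := FiniteDimensional.complete ℝ E
  obtain ⟨k, l, ψ, A, h, hp, hp0⟩ := exists_isGraphChart P p
  obtain ⟨α, θ, h0, hαψ, hα, hα', hθ, hd⟩ :=
    exists_affine_foliation_coordinates ψ.open_target
      (hp0 ▸ ψ.map_source hp) h.smooth (h.contDiffOn_christoffel D)
      (fun z hz a c ↦ h.integrable hz a c)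
      (fun z hz a c ↦ h.christoffel_symm htor hz a c)
      (fun z hz a c v ↦ h.christoffel_flat hflat hz a c v)
  have hχ : IsSmoothChart E (ψ.trans α) := h.chart.trans hα hα'
  have hpχ : p ∈ (ψ.trans α).source := ⟨hp, show ψ p ∈ α.source by rwa [hp0]⟩
  -- Shrinking the image to a ball makes it convex: slices of fixed `y` are then connected, and
  -- their points are joined by segments.
  obtain ⟨r, hr, hball⟩ := Metric.isOpen_iff.1 (ψ.trans α).open_target _
    ((ψ.trans α).map_source hpχ)
  set φ := ((ψ.trans α).symm.restrOpen _ (Metric.isOpen_ball (x := (ψ.trans α) p) (ε := r))).symm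
  have hφ : IsSmoothChart E φ := ⟨hχ.1.mono fun _ hq ↦ hq.1, hχ.2.mono fun _ hz ↦ hz.1⟩
  have hφψ : φ.source ⊆ ψ.source := fun q hq ↦ hq.1.1
  have hφα : ∀ q ∈ φ.source, ψ q ∈ α.source := fun q hq ↦ hq.1.2
  have hαd : ∀ z ∈ α.source, DifferentiableAt ℝ α z := fun z hz ↦
    (hα.contDiffAt (α.open_source.mem_nhds hz)).differentiableAt (by simp)
  have hvdif : ∀ q ∈ φ.source, ∀ v : TangentSpace 𝓘(ℝ, E) q,
      vdif φ q v = fderiv ℝ α (ψ q) (vdif ψ q v) := fun q hq v ↦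
    vdif_comp (hαd _ (hφα q hq)) (h.chart.vdiffAt (hφψ hq)) v
  have hfib : ∀ q ∈ φ.source, ∀ v ∈ P.fiber q, vdif φ q v = (θ (ψ q) (vdif ψ q v).1, 0) := by
    intro q hq v hv
    rw [hvdif q hq, ← (hd _ (hφα q hq) _).1, ← (h.mem_fiber q (hφψ hq) v).1 hv]
  refine ⟨k, l, φ, ⟨hφ, ?_, fun q hq v ↦ ⟨fun hv ↦ by rw [hfib q hq v hv], fun hv ↦ ?_⟩, ?_⟩, ?_⟩
  · have h1 : φ.target = Metric.ball ((ψ.trans α) p) r := inter_eq_right.2 hball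
    rw [h1]
    exact convex_ball _ _
  -- If `θ a = 0`, the vector of `P` with first component `a` is killed by the differential of `φ`.
  -- Injectivity implies surjectivity by dimension, so `P` fills the whole space of vectors with
  -- zero `y`-part.
  · have hinj : Function.Injective (θ (ψ q)) := by
      rw [injective_iff_map_eq_zero]
      intro a ha
      have h1 := hfib q hq _ (h.sec (fun _ ↦ a) q).2
      rw [h.vdif_sec _ (hφψ hq), ha] at h1
      have h2 := hφ.injective hq (h1.trans (map_zero _).symm)
      have h3 := h.vdif_sec (fun _ ↦ a) (hφψ hq)
      rw [h2, map_zero] at h3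
      exact (congrArg Prod.fst h3).symm
    obtain ⟨a, ha⟩ := LinearMap.injective_iff_surjective
      (f := ((θ (ψ q) : (Fin k → ℝ) →L[ℝ] (Fin k → ℝ)) : (Fin k → ℝ) →ₗ[ℝ] (Fin k → ℝ))).1 hinj
      (vdif φ q v).1
    have h1 := hfib q hq _ (h.sec (fun _ ↦ a) q).2
    rw [h.vdif_sec _ (hφψ hq)] at h1
    have h2 : v = h.sec (fun _ ↦ a) q :=
      hφ.injective hq (h1.trans (Prod.ext ha hv.symm)).symm
    rw [h2]
    exact (h.sec (fun _ ↦ a) q).2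
  · intro U hU hUφ Y hY q hq v
    have hqφ := hUφ hq
    have hqψ := hφψ hqφ
    have hY1 := h.vsmooth_fstComp hU (hUφ.trans hφψ) hY
    -- If `Y₁` is the first component in `ψ`, the one in `φ` is `θ Y₁`. Along the leaves `dθ = θ ∘
    -- Γ`, hence `d(θ Y₁) = θ (dY₁ + Γ Y₁)`, which is the `φ`-component of the covariant derivative.
    have h1 : (fun q' ↦ (vdif φ q' (Y.field q')).1) =ᶠ[𝓝 q]
        fun q' ↦ θ (ψ q') (h.fstComp Y q') := by
      filter_upwards [hU.mem_nhds hq] with x hx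
      exact congrArg Prod.fst (hfib x (hUφ hx) _ (Y x).2)
    have h2 : VSmooth E φ.source (fun q ↦ θ (ψ q)) :=
      VSmooth.comp hθ (h.chart.1.mono hφψ) hφα
    have h3 : VSmooth E U (fun q' ↦ θ (ψ q') (h.fstComp Y q')) :=
      (h2.mono hUφ).clm_apply hY1
    have h4 : HasFDerivAt θ (fderiv ℝ θ (ψ q)) (ψ q) :=
      ((hθ.contDiffAt (α.open_source.mem_nhds (hφα q hqφ))).differentiableAt
        (by simp)).hasFDerivAt
    have h5 := (hY1.contDiffOn_symm h.chart).contDiffAt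
      ((ψ.symm.isOpen_inter_preimage hU).mem_nhds
        (⟨ψ.map_source hqψ, by rwa [mem_preimage, ψ.left_inv hqψ]⟩ :
          ψ q ∈ ψ.target ∩ ψ.symm ⁻¹' U))
    have h6 := (h5.differentiableAt (by simp)).hasFDerivAt
    have h7 : (fun z ↦ θ (ψ (ψ.symm z)) (h.fstComp Y (ψ.symm z))) =ᶠ[𝓝 (ψ q)]
        fun z ↦ θ z (h.fstComp Y (ψ.symm z)) := by
      filter_upwards [ψ.open_target.mem_nhds (ψ.map_source hqψ)] with z hz
      rw [ψ.right_inv hz]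
    have hv := (h.mem_fiber q hqψ v).1 v.2
    have hv' : vdif ψ q (v : TangentSpace 𝓘(ℝ, E) q) =
        ((vdif ψ q (v : TangentSpace 𝓘(ℝ, E) q)).1,
          A (ψ q) (vdif ψ q (v : TangentSpace 𝓘(ℝ, E) q)).1) := Prod.ext rfl hv
    rw [hfib q hqφ _ (D.cov Y q v).2, h.fst_vdif_cov D hU (hUφ.trans hφψ) hY hq, vdif_congr h1,
      h.chart.vdif_eq hqψ (h3.vdiffAt hU hq), h.chart.vdif_eq hqψ (hY1.vdiffAt hU hq),
      h7.fderiv_eq, (h4.clm_apply h6).fderiv, hv', ψ.left_inv hqψ]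
    simp [(hd _ (hφα q hqφ) _).2]
  · exact ⟨hpχ, Metric.mem_ball_self hr⟩

end AffineChart

/-! ### Leaves, constant sections and stable forms in an affine chart -/

section AffineChartLemmas

variable {E : Type*} [NormedAddCommGroup E] [NormedSpace ℝ E]
  {M : Type*} [TopologicalSpace M] [ChartedSpace E M]
  {k l : ℕ} {φ : OpenPartialHomeomorph M ((Fin k → ℝ) × (Fin l → ℝ))}

lemma IsSmoothChart.dif_xc (hφ : IsSmoothChart E φ) (i : Fin k) {q : M} (hq : q ∈ φ.source)
    (v : TangentSpace 𝓘(ℝ, E) q) : dif (xc φ i) q v = (vdif φ q v).1 i := by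
  have h1 : HasFDerivAt (fun z : (Fin k → ℝ) × (Fin l → ℝ) ↦ z.1 i)
      ((ContinuousLinearMap.proj i : (Fin k → ℝ) →L[ℝ] ℝ) ∘L ContinuousLinearMap.fst ℝ _ _)
      (φ q) := ((ContinuousLinearMap.proj i : (Fin k → ℝ) →L[ℝ] ℝ) ∘L
        ContinuousLinearMap.fst ℝ (Fin k → ℝ) (Fin l → ℝ)).hasFDerivAt
  have h2 := vdif_comp h1.differentiableAt (hφ.vdiffAt hq) v
  rw [h1.fderiv] at h2
  exact h2

lemma IsSmoothChart.dif_yc (hφ : IsSmoothChart E φ) (i : Fin l) {q : M} (hq : q ∈ φ.source)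
    (v : TangentSpace 𝓘(ℝ, E) q) : dif (yc φ i) q v = (vdif φ q v).2 i := by
  have h1 : HasFDerivAt (fun z : (Fin k → ℝ) × (Fin l → ℝ) ↦ z.2 i)
      ((ContinuousLinearMap.proj i : (Fin l → ℝ) →L[ℝ] ℝ) ∘L ContinuousLinearMap.snd ℝ _ _)
      (φ q) := ((ContinuousLinearMap.proj i : (Fin l → ℝ) →L[ℝ] ℝ) ∘L
        ContinuousLinearMap.snd ℝ (Fin k → ℝ) (Fin l → ℝ)).hasFDerivAt
  have h2 := vdif_comp h1.differentiableAt (hφ.vdiffAt hq) v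
  rw [h1.fderiv] at h2
  exact h2

lemma IsSmoothChart.smoothFun_xc (hφ : IsSmoothChart E φ) (i : Fin k) :
    SmoothFun (E := E) φ.source (xc φ i) :=
  VSmooth.comp (h := fun z : (Fin k → ℝ) × (Fin l → ℝ) ↦ z.1 i) (s := univ)
    ((contDiff_apply ℝ ℝ i).comp contDiff_fst).contDiffOn hφ.1 (mapsTo_univ _ _)

lemma IsSmoothChart.smoothFun_yc (hφ : IsSmoothChart E φ) (i : Fin l) :
    SmoothFun (E := E) φ.source (yc φ i) :=
  VSmooth.comp (h := fun z : (Fin k → ℝ) × (Fin l → ℝ) ↦ z.2 i) (s := univ)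
    ((contDiff_apply ℝ ℝ i).comp contDiff_snd).contDiffOn hφ.1 (mapsTo_univ _ _)

/-- The velocity of a curve in a chart. -/
lemma IsSmoothChart.vdif_mfderivWithin (hφ : IsSmoothChart E φ) {γ : ℝ → M}
    (hγ : ContMDiffOn 𝓘(ℝ, ℝ) 𝓘(ℝ, E) ∞ γ (Icc 0 1)) {t : ℝ} (ht : t ∈ Icc (0 : ℝ) 1)
    (hγt : γ t ∈ φ.source) :
    vdif φ (γ t) (mfderivWithin 𝓘(ℝ, ℝ) 𝓘(ℝ, E) γ (Icc 0 1) t (1 : ℝ)) =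
        derivWithin (fun t ↦ φ (γ t)) (Icc 0 1) t ∧
      DifferentiableWithinAt ℝ (fun t ↦ φ (γ t)) (Icc 0 1) t := by
  have h1 : MDifferentiableWithinAt 𝓘(ℝ, ℝ) 𝓘(ℝ, E) γ (Icc 0 1) t :=
    (hγ t ht).mdifferentiableWithinAt (by simp)
  have h2 := HasMFDerivAt.comp_hasMFDerivWithinAt t (hφ.vdiffAt hγt).hasMFDerivAt
    h1.hasMFDerivWithinAt
  set L : ℝ →L[ℝ] (Fin k → ℝ) × (Fin l → ℝ) :=
    (vdif φ (γ t)).comp (mfderivWithin 𝓘(ℝ, ℝ) 𝓘(ℝ, E) γ (Icc 0 1) t)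
  have h3 : HasFDerivWithinAt (fun t ↦ φ (γ t)) L (Icc 0 1) t := h2.hasFDerivWithinAt
  exact ⟨((HasFDerivWithinAt.hasDerivWithinAt h3).derivWithin
    (uniqueDiffOn_Icc zero_lt_one t ht)).symm, h3.differentiableWithinAt⟩

/-- A function that is constant on the fibers of the second component factors through it. -/
lemma exists_eq_snd {G : M → ℝ}
    (hG : ∀ q ∈ φ.source, ∀ q' ∈ φ.source, (φ q).2 = (φ q').2 → G q = G q') :
    ∃ c : (Fin l → ℝ) → ℝ, ∀ q ∈ φ.source, G q = c (φ q).2 := by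
  classical
  refine ⟨fun y ↦ if h : ∃ q ∈ φ.source, (φ q).2 = y then G h.choose else 0, fun q hq ↦ ?_⟩
  have h : ∃ q' ∈ φ.source, (φ q').2 = (φ q).2 := ⟨q, hq, rfl⟩
  simp only [dif_pos h]
  exact hG q hq _ h.choose_spec.1 h.choose_spec.2.symm

variable [IsManifold 𝓘(ℝ, E) ∞ M] {P : Foliation E M} {D : PartialConnection P}

namespace IsAffineChart

lemma vdif_xField (h : IsAffineChart P D φ) (i : Fin k) {q : M} (hq : q ∈ φ.source) :
    vdif φ q (xField (E := E) φ i q) = (Pi.single i 1, 0) := h.chart.vdif_inverse hq _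

lemma fiber_eq_span (h : IsAffineChart P D φ) {q : M} (hq : q ∈ φ.source) :
    P.fiber q = Submodule.span ℝ (range fun i ↦ xField (E := E) φ i q) := by
  refine le_antisymm (fun v hv ↦ ?_) (Submodule.span_le.2 ?_)
  · rw [Submodule.mem_span_range_iff_exists_fun]
    refine ⟨(vdif φ q v).1, h.chart.injective hq ?_⟩
    simp only [map_sum, map_smul, h.vdif_xField _ hq]
    refine Prod.ext ?_ ?_
    · ext m
      simp [Prod.fst_sum, Pi.single_apply]
    · rw [(h.mem_fiber q hq v).1 hv]
      simp [Prod.snd_sum]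
  · rintro _ ⟨i, rfl⟩
    exact (h.mem_fiber q hq _).2 (congrArg Prod.snd (h.vdif_xField i hq))

/-- A function with vanishing differential along a leaf is constant on it. -/
lemma eq_of_dif_eq_zero (h : IsAffineChart P D φ) {F : M → ℝ}
    (hF : SmoothFun (E := E) φ.source F) {y : Fin l → ℝ}
    (h0 : ∀ q ∈ φ.source, (φ q).2 = y → ∀ v ∈ P.fiber q, dif F q v = 0) {q q' : M}
    (hq : q ∈ φ.source) (hq' : q' ∈ φ.source) (hy : (φ q).2 = y) (hy' : (φ q').2 = y) :
    F q = F q' := by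
  set s : Set (Fin k → ℝ) := (fun x ↦ (x, y)) ⁻¹' φ.target
  have hs : IsOpen s := φ.open_target.preimage (by fun_prop)
  have hs' : Convex ℝ s := by
    intro a ha b hb r t hr ht hrt
    have h1 := h.convex ha hb hr ht hrt
    rw [Prod.smul_mk, Prod.smul_mk, Prod.mk_add_mk, ← add_smul, hrt, one_smul] at h1
    exact h1
  have hg : ContDiffOn ℝ ∞ (fun z ↦ F (φ.symm z)) φ.target :=
    (VSmooth.contDiffOn_symm hF h.chart).mono fun z hz ↦ ⟨hz, φ.map_target hz⟩
  have hd : ∀ x ∈ s, HasFDerivAt (fun x ↦ F (φ.symm (x, y)))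
      (0 : (Fin k → ℝ) →L[ℝ] ℝ) x := by
    intro x hx
    have h1 := ((hg.contDiffAt (φ.open_target.mem_nhds hx)).differentiableAt
      (by simp)).hasFDerivAt
    have h2 : HasFDerivAt (fun x ↦ F (φ.symm (x, y))) _ x :=
      HasFDerivAt.comp (g := fun z ↦ F (φ.symm z)) x h1 (hasFDerivAt_prodMk_left x y)
    refine h2.congr_fderiv (ContinuousLinearMap.ext fun a ↦ ?_)
    have hxs := φ.map_target hx
    have h3 := h.chart.vdif_inverse hxs (a, 0)
    have h4 := h.chart.vdif_eq hxs (VSmooth.vdiffAt (F := ℝ) hF φ.open_source hxs)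
      ((vdif φ (φ.symm (x, y))).inverse (a, 0))
    have h5 := h0 _ hxs (by rw [φ.right_inv hx]) _
      ((h.mem_fiber _ hxs _).2 (congrArg Prod.snd h3))
    rw [h3, φ.right_inv hx] at h4
    exact h4.symm.trans h5
  have h1 := hs.is_const_of_fderiv_eq_zero hs'.isPreconnected
    (fun x hx ↦ (hd x hx).differentiableAt.differentiableWithinAt) (fun x hx ↦ (hd x hx).fderiv)
    (x := (φ q).1) (y := (φ q').1)
    (show ((φ q).1, y) ∈ φ.target by rw [← hy]; exact φ.map_source hq)
    (show ((φ q').1, y) ∈ φ.target by rw [← hy']; exact φ.map_source hq')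
  have h2 : ((φ q).1, y) = φ q := Prod.ext rfl hy.symm
  have h3 : ((φ q').1, y) = φ q' := Prod.ext rfl hy'.symm
  simp only [h2, h3, φ.left_inv hq, φ.left_inv hq'] at h1
  exact h1

/-- Along a curve tangent to `P` the derivative of `y` is zero. Conversely, the image of `φ` is
convex and contains the segment between two points with equal `y`. -/
theorem leaf_eq (h : IsAffineChart P D φ) {q : M} (hq : q ∈ φ.source) :
    P.leaf φ.source q = {q' ∈ φ.source | (φ q').2 = (φ q).2} := by
  ext q'
  constructor
  · rintro ⟨γ, hγ, rfl, rfl, hγt⟩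
    have h1 : (1 : ℝ) ∈ Icc (0 : ℝ) 1 := by simp
    refine ⟨(hγt 1 h1).1, constant_of_derivWithin_zero (f := fun t ↦ (φ (γ t)).2)
      (fun t ht ↦ (h.chart.vdif_mfderivWithin hγ ht (hγt t ht).1).2.snd) (fun t ht ↦ ?_) 1 h1⟩
    obtain ⟨h2, h3⟩ := h.chart.vdif_mfderivWithin hγ (Ico_subset_Icc_self ht)
      (hγt t (Ico_subset_Icc_self ht)).1
    have h4 : HasDerivWithinAt (fun t ↦ (φ (γ t)).2) (derivWithin (fun t ↦ φ (γ t)) (Icc 0 1) t).2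
        (Icc 0 1) t := HasFDerivWithinAt.hasDerivWithinAt h3.hasFDerivWithinAt.snd
    rw [h4.derivWithin (uniqueDiffOn_Icc zero_lt_one t (Ico_subset_Icc_self ht)), ← h2]
    exact (h.mem_fiber _ (hγt t (Ico_subset_Icc_self ht)).1 _).1
      (hγt t (Ico_subset_Icc_self ht)).2
  · rintro ⟨hq', hy⟩
    set c : ℝ → (Fin k → ℝ) × (Fin l → ℝ) := fun t ↦ AffineMap.lineMap (φ q) (φ q') t
    have hc : ContDiff ℝ ∞ c := by
      simp only [c, AffineMap.lineMap_apply_module']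
      fun_prop
    have hct : MapsTo c (Icc 0 1) φ.target := fun t ht ↦
      h.convex.lineMap_mem (φ.map_source hq) (φ.map_source hq') ht
    have hγ : ContMDiffOn 𝓘(ℝ, ℝ) 𝓘(ℝ, E) ∞ (fun t ↦ φ.symm (c t)) (Icc 0 1) :=
      h.chart.2.comp hc.contMDiff.contMDiffOn hct
    refine ⟨fun t ↦ φ.symm (c t), hγ, ?_, ?_, fun t ht ↦ ⟨φ.map_target (hct ht), ?_⟩⟩
    · simp [c, φ.left_inv hq]
    · simp [c, φ.left_inv hq']
    · rw [h.mem_fiber _ (φ.map_target (hct ht)),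
        (h.chart.vdif_mfderivWithin hγ ht (φ.map_target (hct ht))).1,
        derivWithin_congr (f := c) (fun t ht ↦ φ.right_inv (hct ht)) (φ.right_inv (hct ht)),
        (AffineMap.hasDerivWithinAt_lineMap).derivWithin (uniqueDiffOn_Icc zero_lt_one t ht)]
      exact sub_eq_zero.2 hy

/-- The connection differentiates the first components of sections. -/
lemma dif_xc_cov (h : IsAffineChart P D φ) {V : Set M} (hV : IsOpen V) (hVφ : V ⊆ φ.source)
    {Y : P.Sec} (hY : SmoothField V Y.field) {q : M} (hq : q ∈ V) (v : P.fiber q) (j : Fin k) :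
    dif (E := E) (xc φ j) q (D.cov Y q v : TangentSpace 𝓘(ℝ, E) q) =
      dif (E := E) (fun q' ↦ dif (E := E) (xc φ j) q' (Y.field q')) q
        (v : TangentSpace 𝓘(ℝ, E) q) := by
  have h1 : VSmooth E V (fun q' ↦ (vdif φ q' (Y.field q')).1) :=
    VSmooth.comp (h := Prod.fst) (s := univ) contDiff_fst.contDiffOn
      (VSmooth.vdif_apply hV (h.chart.1.mono hVφ) hY) (mapsTo_univ _ _)
  have h2 : HasFDerivAt (fun a : Fin k → ℝ ↦ a j) (ContinuousLinearMap.proj j)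
      (vdif φ q (Y.field q)).1 := (ContinuousLinearMap.proj j : (Fin k → ℝ) →L[ℝ] ℝ).hasFDerivAt
  have h3 := vdif_comp (f := fun q' ↦ (vdif φ q' (Y.field q')).1) h2.differentiableAt
    (h1.vdiffAt hV hq) (v : TangentSpace 𝓘(ℝ, E) q)
  have h4 : (fun q' ↦ dif (E := E) (xc φ j) q' (Y.field q')) =ᶠ[𝓝 q]
      fun q' ↦ (vdif φ q' (Y.field q')).1 j := by
    filter_upwards [hV.mem_nhds hq] with x hx using h.chart.dif_xc j (hVφ hx) _
  rw [h2.fderiv, ← h.fst_vdif_cov V hV hVφ Y hY q hq v] at h3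
  rw [h.chart.dif_xc j (hVφ hq)]
  exact h3.symm.trans (DFunLike.congr_fun (vdif_congr h4) (v : TangentSpace 𝓘(ℝ, E) q)).symm

/-- Stability of `dx^j` is `X(dx^j(Y)) = dx^j(∇_X Y)`, the statement that `∇` differentiates
`x`-components. It makes closure under the Koszul bracket applicable to coordinate differentials. -/
lemma stable_dif_xc (h : IsAffineChart P D φ) (j : Fin k) :
    D.Stable φ.source (dif (E := E) (xc φ j)) :=
  ⟨(h.chart.smoothFun_xc j).dif φ.open_source, fun _ hV hVφ X _ _ hY x hx ↦
    (h.dif_xc_cov hV hVφ hY hx (X x) j).symm⟩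

open Classical in
/-- The section of the tangent distribution with constant components `a`. -/
noncomputable def constSec (h : IsAffineChart P D φ) (a : Fin k → ℝ) : P.Sec := fun q ↦
  if hq : q ∈ φ.source then ⟨(vdif φ q).inverse (a, 0), by
    rw [h.mem_fiber q hq, h.chart.vdif_inverse hq]⟩ else 0

lemma vdif_constSec (h : IsAffineChart P D φ) (a : Fin k → ℝ) {q : M} (hq : q ∈ φ.source) :
    vdif φ q ((h.constSec a).field q) = (a, 0) := by
  rw [Foliation.Sec.field, constSec, dif_pos hq]
  exact h.chart.vdif_inverse hq _

lemma smoothField_constSec (h : IsAffineChart P D φ) (a : Fin k → ℝ) :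
    SmoothField φ.source (h.constSec a).field := by
  refine (h.chart.smoothField Subset.rfl (V := fun _ ↦ (a, 0)) contMDiffOn_const).congr
    fun q hq ↦ ?_
  simp [Foliation.Sec.field, constSec, hq]

lemma constSec_fst (h : IsAffineChart P D φ) {q : M} (hq : q ∈ φ.source) (v : P.fiber q) :
    h.constSec (vdif φ q (v : TangentSpace 𝓘(ℝ, E) q)).1 q = v := by
  refine Subtype.ext (h.chart.injective hq ((h.vdif_constSec _ hq).trans ?_))
  exact Prod.ext rfl ((h.mem_fiber q hq v).1 v.2).symm

/-- Constant sections form a parallel frame of `P`, against which a stable form has leafwise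
constant coefficients. -/
lemma cov_constSec (h : IsAffineChart P D φ) (a : Fin k → ℝ) {q : M} (hq : q ∈ φ.source) :
    D.cov (h.constSec a) q = 0 := by
  ext v
  refine h.chart.injective hq (Prod.ext ?_ ?_)
  · have h1 : (fun q' ↦ (vdif φ q' ((h.constSec a).field q')).1) =ᶠ[𝓝 q] fun _ ↦ a := by
      filter_upwards [φ.open_source.mem_nhds hq] with x hx
      rw [h.vdif_constSec a hx]
    rw [h.fst_vdif_cov _ φ.open_source Subset.rfl _ (h.smoothField_constSec a) q hq v,
      vdif_congr h1]
    have h2 : vdif (E := E) (fun _ : M ↦ a) q = 0 := mfderiv_const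
    rw [h2]
    simp
  · rw [(h.mem_fiber q hq _).1 (D.cov (h.constSec a) q v).2]
    simp

end IsAffineChart

end AffineChartLemmas

/-! ### Components of the Poisson bivector -/

section Bracket

variable {E : Type*} [NormedAddCommGroup E] [NormedSpace ℝ E]
  {M : Type*} [TopologicalSpace M] [ChartedSpace E M] [IsManifold 𝓘(ℝ, E) ∞ M]
  {k l : ℕ} {φ : OpenPartialHomeomorph M ((Fin k → ℝ) × (Fin l → ℝ))}
  {π : PoissonStructure E M} {P : Foliation E M} {D : PartialConnection P}

lemma PoissonStructure.smoothFun_bracket {U : Set M} (hU : IsOpen U) {f g : M → ℝ}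
    (hf : SmoothFun (E := E) U f) (hg : SmoothFun (E := E) U g) :
    SmoothFun (E := E) U (π.bracket f g) :=
  (hg.dif hU).apply (π.smooth U hU _ (hf.dif hU))

/-- Exact forms are closed, so only the term `d(π(df, dg))` of the Koszul bracket survives. -/
lemma PoissonStructure.koszul_dif {U : Set M} (hU : IsOpen U) {f g : M → ℝ}
    (hf : SmoothFun (E := E) U f) (hg : SmoothFun (E := E) U g) {q : M} (hq : q ∈ U) :
    π.koszul (dif f) (dif g) q = dif (π.bracket f g) q := by
  rw [PoissonStructure.koszul, extD_dif hU hf hq, extD_dif hU hg hq]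
  simp
  rfl

namespace IsAffineChart

lemma sharp_dif_yc_mem (h : IsAffineChart P D φ) (hD : IsRealPolarization π P D) (a : Fin l)
    {q : M} (hq : q ∈ φ.source) : π.sharp q (dif (yc φ a) q) ∈ P.fiber q := by
  refine hD.coisotropic q _ fun v hv ↦ ?_
  rw [h.chart.dif_yc a hq, (h.mem_fiber q hq v).1 hv]
  rfl

/-- By coisotropy `#dy^a` is tangent to the leaves, and `dy^b` annihilates them. -/
theorem bracket_yc_yc (h : IsAffineChart P D φ) (hD : IsRealPolarization π P D) (a b : Fin l)
    {q : M} (hq : q ∈ φ.source) : π.bracket (yc φ a) (yc φ b) q = 0 := by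
  refine (h.chart.dif_yc b hq _).trans ?_
  rw [(h.mem_fiber q hq _).1 (h.sharp_dif_yc_mem hD a hq)]
  rfl

/-- `y^a` is constant along `P`, so `sharp_parallel` makes `#dy^a` a parallel section of `P`. Its
components are the brackets `{y^a, x^i}`, and parallel means that they are constant along the
leaves. -/
theorem bracket_xc_yc (h : IsAffineChart P D φ) (hD : IsRealPolarization π P D) (i : Fin k)
    (a : Fin l) : ∃ c : (Fin l → ℝ) → ℝ,
      ∀ q ∈ φ.source, π.bracket (xc φ i) (yc φ a) q = c (φ q).2 := by
  classical
  set Y : P.Sec := fun q ↦ if hq : q ∈ φ.source then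
    ⟨π.sharp q (dif (yc φ a) q), h.sharp_dif_yc_mem hD a hq⟩ else 0
  have hYq : ∀ q ∈ φ.source, Y.field q = π.sharp q (dif (yc φ a) q) := fun q hq ↦ by
    simp [Foliation.Sec.field, Y, hq]
  have hY : SmoothField φ.source Y.field :=
    (π.smooth _ φ.open_source _ ((h.chart.smoothFun_yc a).dif φ.open_source)).congr
      fun q hq ↦ by rw [hYq q hq]
  have hcov := hD.sharp_parallel φ.source φ.open_source _ (h.chart.smoothFun_yc a)
    (fun q hq v hv ↦ by rw [h.chart.dif_yc a hq, (h.mem_fiber q hq v).1 hv]; rfl) Y hYq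
  have hd : ∀ q ∈ φ.source, ∀ v ∈ P.fiber q, dif (π.bracket (yc φ a) (xc φ i)) q v = 0 := by
    intro q hq v hv
    have h1 := h.dif_xc_cov φ.open_source Subset.rfl hY hq ⟨v, hv⟩ i
    have h2 : π.bracket (yc φ a) (xc φ i) =ᶠ[𝓝 q]
        fun q' ↦ dif (E := E) (xc φ i) q' (Y.field q') := by
      filter_upwards [φ.open_source.mem_nhds hq] with x hx
      rw [hYq x hx]
      rfl
    rw [hcov q hq] at h1
    exact (DFunLike.congr_fun (vdif_congr h2) v).trans (h1.symm.trans (map_zero _))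
  refine exists_eq_snd fun q hq q' hq' hy ↦ ?_
  have h1 := h.eq_of_dif_eq_zero (PoissonStructure.smoothFun_bracket φ.open_source
    (h.chart.smoothFun_yc a) (h.chart.smoothFun_xc i)) (fun q hq _ ↦ hd q hq) hq hq' hy rfl
  have h2 : ∀ q, π.bracket (xc φ i) (yc φ a) q = -π.bracket (yc φ a) (xc φ i) q := fun q ↦
    π.antisymm q _ _
  rw [h2, h2, h1]

/-- By `stable_koszul`, `d{x^i, x^j} = [dx^i, dx^j]_π` is stable. Its values `G a` on the parallel
sections `constSec a` are therefore constant on each leaf; they supply the slopes `b`, and what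
remains after subtracting the linear part is constant on leaves. -/
theorem bracket_xc_xc (h : IsAffineChart P D φ) (hD : IsRealPolarization π P D) (i j : Fin k) :
    ∃ (c : (Fin l → ℝ) → ℝ) (b : Fin k → (Fin l → ℝ) → ℝ),
      ∀ q ∈ φ.source, π.bracket (xc φ i) (xc φ j) q
        = c (φ q).2 + ∑ m : Fin k, b m (φ q).2 * xc φ m q := by
  set F : M → ℝ := π.bracket (xc φ i) (xc φ j)
  have hF : SmoothFun (E := E) φ.source F := PoissonStructure.smoothFun_bracket φ.open_source
    (h.chart.smoothFun_xc i) (h.chart.smoothFun_xc j)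
  set G : (Fin k → ℝ) → M → ℝ := fun a q ↦ dif F q ((h.constSec a).field q)
  have hG : ∀ a, SmoothFun (E := E) φ.source (G a) := fun a ↦
    (hF.dif φ.open_source).apply (h.smoothField_constSec a)
  have hK := hD.stable_koszul φ.source φ.open_source _ _ (h.stable_dif_xc i) (h.stable_dif_xc j)
  have hG0 : ∀ a, ∀ q ∈ φ.source, ∀ v ∈ P.fiber q, dif (G a) q v = 0 := by
    intro a q hq v hv
    have h1 := hK.2 φ.source φ.open_source Subset.rfl _ _
      (h.smoothField_constSec (vdif φ q v).1) (h.smoothField_constSec a) q hq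
    have h2 : (h.constSec (vdif φ q v).1).field q = v :=
      congrArg Subtype.val (h.constSec_fst hq ⟨v, hv⟩)
    have h3 : (D.along (h.constSec (vdif φ q v).1) (h.constSec a)).field q = 0 := by
      simp [Foliation.Sec.field, PartialConnection.along, h.cov_constSec a hq]
    have h4 : G a =ᶠ[𝓝 q]
        fun q' ↦ π.koszul (dif (xc φ i)) (dif (xc φ j)) q' ((h.constSec a).field q') := by
      filter_upwards [φ.open_source.mem_nhds hq] with x hx
      rw [PoissonStructure.koszul_dif φ.open_source (h.chart.smoothFun_xc i)
        (h.chart.smoothFun_xc j) hx]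
    rw [h2, h3, map_zero] at h1
    exact (DFunLike.congr_fun (vdif_congr h4) v).trans h1
  have hGc : ∀ a, ∀ q ∈ φ.source, ∀ q' ∈ φ.source, (φ q).2 = (φ q').2 → G a q = G a q' :=
    fun a q hq q' hq' hy ↦ h.eq_of_dif_eq_zero (hG a) (fun q hq _ ↦ hG0 a q hq) hq hq' hy rfl
  choose b hb using fun m : Fin k ↦ exists_eq_snd (hGc (Pi.single m 1))
  have hdF : ∀ q ∈ φ.source, ∀ v ∈ P.fiber q,
      dif F q v = ∑ m, b m (φ q).2 * (vdif φ q v).1 m := by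
    intro q hq v hv
    have h1 : v = ∑ m, (vdif φ q v).1 m • (h.constSec (Pi.single m 1)).field q := by
      refine h.chart.injective hq (Prod.ext ?_ ?_)
      · ext n
        simp [h.vdif_constSec _ hq, Prod.fst_sum, Pi.single_apply]
      · rw [(h.mem_fiber q hq v).1 hv]
        simp [h.vdif_constSec _ hq, Prod.snd_sum]
    conv_lhs => rw [h1]
    simp only [map_sum, map_smul, smul_eq_mul]
    exact Finset.sum_congr rfl fun m _ ↦ (mul_comm _ _).trans (by rw [← hb m q hq])
  obtain ⟨c, hc⟩ := exists_eq_snd (φ := φ) (G := fun q ↦ F q - ∑ m, b m (φ q).2 * xc φ m q) (by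
    intro q hq q' hq' hy
    -- The slopes are frozen at the leaf of `q'`, since nothing is known here about the smoothness
    -- of `b` in `y`. The differential of `F - L ∘ φ` along `P` needs to vanish only on that leaf.
    set L : (Fin k → ℝ) × (Fin l → ℝ) →L[ℝ] ℝ := ∑ m, b m (φ q').2 •
      ((ContinuousLinearMap.proj m : (Fin k → ℝ) →L[ℝ] ℝ) ∘L ContinuousLinearMap.fst ℝ _ _)
    have hL : ∀ z, L z = ∑ m, b m (φ q').2 * z.1 m := fun z ↦ by simp [L]
    have hLs : SmoothFun (E := E) φ.source (fun q ↦ L (φ q)) :=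
      VSmooth.comp (h := L) (s := univ) L.contDiff.contDiffOn h.chart.1 (mapsTo_univ _ _)
    have h1 := h.eq_of_dif_eq_zero (F := fun q ↦ F q - L (φ q)) (hF.sub hLs) (y := (φ q').2)
      (fun x hx hxy v hv ↦ ?_) hq hq' hy rfl
    · simpa only [hL, hy, xc] using h1
    · have h2 : dif (E := E) (fun q ↦ F q - L (φ q)) x v =
          dif F x v - vdif (fun q ↦ L (φ q)) x v :=
        DFunLike.congr_fun (HasMFDerivAt.sub
          (VSmooth.vdiffAt (F := ℝ) hF φ.open_source hx).hasMFDerivAt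
          (VSmooth.vdiffAt (F := ℝ) hLs φ.open_source hx).hasMFDerivAt).mfderiv v
      rw [h2, hdF x hx v hv, vdif_comp L.differentiableAt (h.chart.vdiffAt hx), L.fderiv, hL, hxy,
        sub_self])
  exact ⟨c, b, fun q hq ↦ sub_eq_iff_eq_add.1 (hc q hq)⟩

end IsAffineChart

end Bracket

end PoissonPolarization

/-! ### The adapted coordinates -/

theorem mainTheorem8 {E : Type*} [NormedAddCommGroup E] [NormedSpace ℝ E] [FiniteDimensional ℝ E]
    {M : Type*} [TopologicalSpace M] [T2Space M] [ChartedSpace E M] [IsManifold 𝓘(ℝ, E) ∞ M]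
    (π : PoissonStructure E M) (P : Foliation E M) (D : PartialConnection P)
    (hD : IsRealPolarization π P D) (p : M) :
    ∃ (k l : ℕ) (φ : OpenPartialHomeomorph M ((Fin k → ℝ) × (Fin l → ℝ))),
      p ∈ φ.source ∧ IsCoordinates (E := E) φ ∧
      -- (1) the leaves are the subspaces of fixed y
      (∀ q ∈ φ.source, P.leaf φ.source q = {q' ∈ φ.source | (φ q').2 = (φ q).2}) ∧
      -- (2) the ∂/∂x^i span the tangent spaces of the leaves, and ∇ along ∂/∂x^i differentiates
      -- the x-components of sections in the direction ∂/∂x^i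
      (∀ q ∈ φ.source, P.fiber q = Submodule.span ℝ (Set.range fun i ↦ xField (E := E) φ i q)) ∧
      (∀ V : Set M, IsOpen V → V ⊆ φ.source → ∀ Y : P.Sec, SmoothField V Y.field → ∀ q ∈ V,
        ∀ (i : Fin k) (v : P.fiber q), (v : TangentSpace 𝓘(ℝ, E) q) = xField φ i q →
          ∀ j : Fin k, dif (E := E) (xc φ j) q (D.cov Y q v : TangentSpace 𝓘(ℝ, E) q) =
            dif (E := E) (fun q' ↦ dif (E := E) (xc φ j) q' (Y.field q')) q (xField φ i q)) ∧
      -- (3) the y-y components of π vanish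
      (∀ a b : Fin l, ∀ q ∈ φ.source, π.bracket (yc φ a) (yc φ b) q = 0) ∧
      -- (4) the x-y components of π are constant in the x's
      (∀ (i : Fin k) (a : Fin l), ∃ c : (Fin l → ℝ) → ℝ,
        ∀ q ∈ φ.source, π.bracket (xc φ i) (yc φ a) q = c (φ q).2) ∧
      -- (5) the x-x components of π are affine in the x's
      (∀ i j : Fin k, ∃ (c : (Fin l → ℝ) → ℝ) (b : Fin k → (Fin l → ℝ) → ℝ),
        ∀ q ∈ φ.source, π.bracket (xc φ i) (xc φ j) q
          = c (φ q).2 + ∑ m : Fin k, b m (φ q).2 * xc φ m q) := by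
  obtain ⟨k, l, φ, h, hp⟩ := exists_isAffineChart P hD.torsionFree hD.flat p
  refine ⟨k, l, φ, hp, h.chart, fun q hq ↦ h.leaf_eq hq, fun q hq ↦ h.fiber_eq_span hq,
    fun V hV hVφ Y hY q hq i v hv j ↦ ?_, fun a b q hq ↦ h.bracket_yc_yc hD a b hq,
    fun i a ↦ h.bracket_xc_yc hD i a, fun i j ↦ h.bracket_xc_xc hD i j⟩
  rw [← hv]
  exact h.dif_xc_cov hV hVφ hY hq v j
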